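/- Let $m>0$, $\beta>0$, $\epsilon(k)=(k^2+m^2)^{1/2}$, $\rho(k)=(e^{\beta\epsilon(k)}-1)^{-1}$, $\mathfrak h=L^2(\mathbb R,dk)$, and let $\mathfrak h_\kappa$ be the real subspace of all $f\in\mathfrak h$ with $f(-k)=\overline{f(k)}$. Let $(Q,\Sigma_0,\mu)$ be a probability space carrying the time-zero neutral Klein–Gordon field of mass $m$ at inverse temperature $\beta$, i.e. a real-linear map $f\mapsto\phi_\omega(f)$ from $\mathfrak h_\kappa$ to the real random variables (modulo null sets) with $$\int_Q e^{i\phi_\omega(f)}\,d\mu=e^{-\frac14(f,(1+2\rho)f)},\qquad f\in\mathfrak h_\kappa .$$ Fix a real $\chi\in C_0^\infty(\mathbb R)$ with $\int\chi=1$, put $\hat\chi(k)=\int e^{-iky}\chi(y)\,dy$, and for $\Lambda\in[1,\infty)$, $x\in\mathbb R$ set $$f_{\Lambda,x}(k)=(4\pi)^{-1/2}e^{-ikx}\hat\chi(k/\Lambda)\epsilon(k)^{-1/2},\qquad \phi_\Lambda(x)=\sqrt2\,\phi_\omega(f_{\Lambda,x})=\phi_\omega(\sqrt2 f_{\Lambda,x}).$$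 For a quadratic form $c$ on $\mathfrak h_\kappa$ let $:\!e^{\alpha\phi_\omega(f)}\!:_c\;=e^{\alpha\phi_\omega(f)}e^{-\frac{\alpha^2}{2}c(f,f)}$, and write $:\;:_0$ and $:\;:_\beta$ for the choices $c_0(f,f)=\frac12(f,f)$ and $c_\beta(f,f)=\frac12(f,(1+2\rho)f)$. Let $g\in L^1(\mathbb R)\cap L^2(\mathbb R)$ be real with $g\ge0$, and let $\alpha\in\mathbb R$ with $|\alpha|<\sqrt{2\pi}$. Then for every $\Lambda\ge 1$ the integrals $$V_\Lambda=\int g(x):\!e^{\alpha\phi_\Lambda(x)}\!:_0\,dx,\qquad V_{\Lambda,\beta}=\int g(x):\!e^{\alpha\phi_\Lambda(x)}\!:_\beta\,dx$$ exist as (Bochner) integrals in $L^2(Q,\Sigma_0,\mu)$. The family $\{V_\Lambda\}$ is Cauchy in $L^2(Q,\Sigma_0,\mu)$ as $\Lambda\to\infty$ and converges to some $V\in L^2(Q,\Sigma_0,\mu)$ with $V\ge0$ almost everywhere. Likewise, $\{V_{\Lambda,\beta}\}$ is Cauchy in $L^2(Q,\Sigma_0,\mu)$ and converges to some $V_\beta\in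 L^2(Q,\Sigma_0,\mu)$ with $V_\beta\ge0$ almost everywhere. -/

import Mathlib

open MeasureTheory Filter Topology ProbabilityTheory
open scoped ENNReal NNReal ContDiff

namespace HoeghKrohn

noncomputable section

/-! ### One-particle data of the neutral Klein-Gordon field on the line (momentum representation) -/

/-- The relativistic one-particle energy `ε(k) = (k² + m²)^{1/2}`. -/
def energy (m k : ℝ) : ℝ := Real.sqrt (k ^ 2 + m ^ 2)

/-- The thermal density `ρ(k) = (e^{β ε(k)} - 1)⁻¹`. -/
def thermalDensity (m β k : ℝ) : ℝ := (Real.exp (β * energy m k) - 1)⁻¹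

theorem energy_pos {m : ℝ} (hm : 0 < m) (k : ℝ) : 0 < energy m k :=
  Real.sqrt_pos.2 (by positivity)

theorem le_energy (m : ℝ) (k : ℝ) : m ≤ energy m k :=
  Real.le_sqrt_of_sq_le (by nlinarith [sq_nonneg k])

theorem continuous_energy (m : ℝ) : Continuous (energy m) := by
  unfold energy; fun_prop

/-- The one-particle space `𝔥 = L²(ℝ, dk)`. -/
abbrev OneParticle : Type := Lp ℂ 2 (volume : Measure ℝ)

/-- The real subspace `𝔥_κ` of vectors fixed by the time reversal `κ`. In position space `κ` is
complex conjugation, so in momentum space `(κ f)(k) = conj (f (-k))`. -/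
def realSubspace : Submodule ℝ OneParticle where
  carrier := {f | ∀ᵐ k : ℝ, f (-k) = star (f k)}
  add_mem' := by
    intro f g hf hg
    have hneg : Measure.QuasiMeasurePreserving (fun k : ℝ => -k) volume volume :=
      (Measure.measurePreserving_neg (volume : Measure ℝ)).quasiMeasurePreserving
    have h1 := Lp.coeFn_add f g
    have h2 := hneg.ae h1
    filter_upwards [hf, hg, h1, h2] with k a b c d
    rw [c, d, Pi.add_apply, Pi.add_apply, a, b, star_add]
  zero_mem' := by
    have hneg : Measure.QuasiMeasurePreserving (fun k : ℝ => -k) volume volume :=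
      (Measure.measurePreserving_neg (volume : Measure ℝ)).quasiMeasurePreserving
    have h1 := Lp.coeFn_zero ℂ 2 (volume : Measure ℝ)
    have h2 := hneg.ae h1
    filter_upwards [h1, h2] with k c d
    rw [c, d]; simp
  smul_mem' := by
    intro r f hf
    have hneg : Measure.QuasiMeasurePreserving (fun k : ℝ => -k) volume volume :=
      (Measure.measurePreserving_neg (volume : Measure ℝ)).quasiMeasurePreserving
    have h1 := Lp.coeFn_smul r f
    have h2 := hneg.ae h1
    filter_upwards [hf, h1, h2] with k a c d
    rw [c, d, Pi.smul_apply, Pi.smul_apply, a, star_smul, star_trivial r]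

/-- The covariance at temperature zero, `c₀(f, f) = ½ (f, f)`. -/
def covZero (f : realSubspace) : ℝ := (1 / 2) * ‖(f : OneParticle)‖ ^ 2

/-- The covariance at inverse temperature `β`, `c_β(f, f) = ½ (f, (1 + 2ρ) f)`. -/
def covBeta (m β : ℝ) (f : realSubspace) : ℝ :=
  (1 / 2) * ∫ k : ℝ, (1 + 2 * thermalDensity m β k) * ‖(f : OneParticle) k‖ ^ 2

/-! ### The time-zero field at inverse temperature `β` -/

/-- A realization on the probability space `(Q, Σ₀, μ)` of the time-zero neutral Klein-Gordon
field of mass `m` at inverse temperature `β`: a real-linear map `f ↦ φ_ω(f)` from `𝔥_κ` to real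
random variables modulo null sets, such that `e^{i φ_ω(f)}` has, as the Weyl operator `W(f)` in
the thermal state `ω_β`, the expectation `ω_β(W(f)) = exp(-¼ (f, (1 + 2ρ) f))`.
By linearity this fixes the joint law of the field: it is the centred Gaussian process indexed by
`𝔥_κ` with covariance `c_β`. (A representative `Σ₀`-measurable function is part of the notion of
an element of `Q →ₘ[μ] ℝ`.) -/
structure ThermalField (m β : ℝ) {Q : Type*} [MeasurableSpace Q] (μ : Measure Q) where
  /-- the field `φ_ω` -/
  field : realSubspace →ₗ[ℝ] (Q →ₘ[μ] ℝ)
  /-- the value of the thermal state on the Weyl operators of `𝔥_κ` -/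
  expectation_weyl : ∀ f : realSubspace,
    ∫ q, Complex.exp (Complex.I * (field f q : ℂ)) ∂μ
      = Complex.exp (-(1 / 4) *
          ((∫ k : ℝ, (1 + 2 * thermalDensity m β k) * ‖(f : OneParticle) k‖ ^ 2 : ℝ) : ℂ))

/-! ### Realizations exist -/

theorem norm_integral_exp_sub_le {Q : Type*} [MeasurableSpace Q] (P : Measure Q)
    [IsProbabilityMeasure P] (Y Z : Lp ℝ 2 P) :
    ‖(∫ q, Complex.exp (Complex.I * (Y q : ℂ)) ∂P) - ∫ q, Complex.exp (Complex.I * (Z q : ℂ)) ∂P‖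
      ≤ ‖Y - Z‖ := by
  have hint : ∀ W : Lp ℝ 2 P, Integrable (fun q => Complex.exp (Complex.I * (W q : ℂ))) P := by
    intro W
    have hW := (Lp.memLp W).1
    refine Integrable.of_bound (C := 1) ?_ (Eventually.of_forall fun q => ?_)
    · exact (by fun_prop : Continuous fun r : ℝ => Complex.exp (Complex.I * (r : ℂ)))
        |>.comp_aestronglyMeasurable hW
    · rw [Complex.norm_exp]; simp
  have hYZ : MemLp (fun q => Y q - Z q) 2 P := (Lp.memLp Y).sub (Lp.memLp Z)
  have h1 : ∀ q, ‖Complex.exp (Complex.I * (Y q : ℂ)) - Complex.exp (Complex.I * (Z q : ℂ))‖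
      ≤ ‖Y q - Z q‖ := by
    intro q
    have e : Complex.exp (Complex.I * (Y q : ℂ)) - Complex.exp (Complex.I * (Z q : ℂ))
        = Complex.exp (Complex.I * (Z q : ℂ)) *
          (Complex.exp (Complex.I * ((Y q - Z q : ℝ) : ℂ)) - 1) := by
      rw [mul_sub, ← Complex.exp_add]; push_cast; ring_nf
    have hn : ‖Complex.exp (Complex.I * (Z q : ℂ))‖ = 1 := by rw [Complex.norm_exp]; simp
    rw [e, norm_mul, hn, one_mul]
    exact Real.norm_exp_I_mul_ofReal_sub_one_le
  rw [← integral_sub (hint Y) (hint Z)]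
  refine (norm_integral_le_integral_norm _).trans ?_
  refine (integral_mono ((hint Y).sub (hint Z)).norm
    (hYZ.integrable (by norm_num)).norm h1).trans ?_
  have h2 : eLpNorm (fun q => Y q - Z q) 1 P ≤ eLpNorm (fun q => Y q - Z q) 2 P :=
    eLpNorm_le_eLpNorm_of_exponent_le (by norm_num) hYZ.1
  have h3 : ∫ q, ‖Y q - Z q‖ ∂P = (eLpNorm (fun q => Y q - Z q) 1 P).toReal := by
    rw [eLpNorm_one_eq_lintegral_enorm, integral_norm_eq_lintegral_enorm hYZ.1]
  rw [h3, Lp.norm_def, eLpNorm_congr_ae (Lp.coeFn_sub Y Z)]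
  exact ENNReal.toReal_mono hYZ.2.ne h2

/-- The isonormal Gaussian process over a real Hilbert space exists. -/
theorem exists_isonormal (H : Type) [NormedAddCommGroup H] [InnerProductSpace ℝ H]
    [CompleteSpace H] :
    ∃ (Q : Type) (_ : MeasurableSpace Q) (P : Measure Q) (_ : IsProbabilityMeasure P)
      (J : H →ₗ[ℝ] Lp ℝ 2 P), ∀ h : H,
        ∫ q, Complex.exp (Complex.I * (J h q : ℂ)) ∂P = Complex.exp (-(1 / 2) * ((‖h‖ ^ 2 : ℝ) : ℂ)) := by
  obtain ⟨w, b, -⟩ := exists_hilbertBasis ℝ H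
  let P : Measure (w → ℝ) := Measure.infinitePi fun _ => gaussianReal 0 1
  have hlaw : ∀ i : w, P.map (fun q => q i) = gaussianReal 0 1 := fun i =>
    Measure.infinitePi_map_eval _ i
  have hmp : ∀ i : w, MeasurePreserving (fun q : w → ℝ => q i) P (gaussianReal 0 1) := fun i =>
    ⟨by fun_prop, hlaw i⟩
  have hind : iIndepFun (fun (i : w) (q : w → ℝ) => q i) P :=
    iIndepFun_infinitePi (P := fun _ : w => gaussianReal 0 1) (X := fun _ x => x)
      (fun _ => measurable_id)
  have hmem : ∀ i : w, MemLp (fun q : w → ℝ => q i) 2 P := fun i =>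
    (memLp_id_gaussianReal' (μ := 0) (v := 1) 2 (by norm_num)).comp_measurePreserving (hmp i)
  have hev : ∀ i : w, Measurable fun q : w → ℝ => q i := fun i => measurable_pi_apply i
  let X : w → Lp ℝ 2 P := fun i => (hmem i).toLp
  have hX : Orthonormal ℝ X := by
    classical
    rw [orthonormal_iff_ite]
    intro i j
    have e : inner ℝ (X i) (X j) = ∫ q : w → ℝ, q i * q j ∂P := by
      rw [L2.inner_def]
      refine integral_congr_ae ?_
      filter_upwards [(hmem i).coeFn_toLp, (hmem j).coeFn_toLp] with q h1 h2
      change inner ℝ ((hmem i).toLp _ q) ((hmem j).toLp _ q) = _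
      rw [h1, h2]; simp [mul_comm]
    have hmean : ∀ i : w, ∫ q : w → ℝ, q i ∂P = 0 := by
      intro i
      have := integral_map (μ := P) (φ := fun q : w → ℝ => q i) (hev i).aemeasurable
        (f := fun x : ℝ => x) (by fun_prop)
      rw [← this, hlaw, integral_id_gaussianReal]
    rw [e]
    split_ifs with hij
    · subst hij
      have h1 := integral_map (μ := P) (φ := fun q : w → ℝ => q i) (hev i).aemeasurable
        (f := fun x : ℝ => x * x) (by fun_prop)
      rw [← h1, hlaw]
      have h2 := variance_fun_id_gaussianReal (μ := 0) (v := 1)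
      rw [variance_of_integral_eq_zero (by fun_prop) (by simp)] at h2
      simpa [sq] using h2
    · rw [(hind.indepFun hij).integral_fun_mul_eq_mul_integral
        (hev i).aestronglyMeasurable (hev j).aestronglyMeasurable,
        hmean, zero_mul]
  let L : lp (fun _ : w => ℝ) 2 →ₗᵢ[ℝ] Lp ℝ 2 P := hX.orthogonalFamily.linearIsometry
  refine ⟨w → ℝ, inferInstance, P, inferInstance, L.toLinearMap ∘ₗ b.repr.toLinearMap, fun h => ?_⟩
  change ∫ q, Complex.exp (Complex.I * (L (b.repr h) q : ℂ)) ∂P = _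
  obtain ⟨a, ha⟩ : ∃ a : w → ℝ, ∀ i, b.repr h i = a i := ⟨_, fun _ => rfl⟩
  have hsum : HasSum (fun i => b.repr h i • X i) (L (b.repr h)) :=
    hX.orthogonalFamily.hasSum_linearIsometry (b.repr h)
  have hnorm : HasSum (fun i => (b.repr h i) ^ 2) (‖h‖ ^ 2) := by
    have := lp.hasSum_norm (p := 2) (by norm_num) (b.repr h)
    simpa using this
  simp_rw [ha] at hsum hnorm
  have hfin : ∀ s : Finset w,
      ∫ q, Complex.exp (Complex.I * ((∑ i ∈ s, a i • X i : Lp ℝ 2 P) q : ℂ)) ∂P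
        = Complex.exp (-(1 / 2) * ((∑ i ∈ s, (a i) ^ 2 : ℝ) : ℂ)) := by
    intro s
    have hind2 : iIndepFun (fun (i : w) (q : w → ℝ) => a i * q i) P :=
      hind.comp (fun i x => a i * x) (fun i => by fun_prop)
    have h1 := iIndepFun.charFun_map_fun_finsetSum_eq_prod (s := s)
      (X := fun (i : w) (q : w → ℝ) => a i * q i) (P := P)
      (fun i _ => ((hev i).const_mul (a i)).aemeasurable) (hind2.restrict s)
    have h2 := congrFun h1 1
    have h3 : (((∑ i ∈ s, a i • X i : Lp ℝ 2 P)) : (w → ℝ) → ℝ)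
        =ᵐ[P] fun q => ∑ i ∈ s, a i * q i := by
      have hall : ∀ᵐ q ∂P, ∀ i ∈ s, (a i • X i : Lp ℝ 2 P) q = a i * q i := by
        refine (ae_ball_iff (S := (s : Set w)) s.countable_toSet).2 fun i _ => ?_
        filter_upwards [Lp.coeFn_smul (a i) (X i), (hmem i).coeFn_toLp] with q h1 h2
        rw [h1, Pi.smul_apply, smul_eq_mul]
        congr 1
      filter_upwards [Lp.coeFn_finsetSum s (fun i => a i • X i), hall] with q h1 h2
      rw [h1, Finset.sum_apply]
      exact Finset.sum_congr rfl h2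
    rw [charFun_apply_real, integral_map
      (Finset.measurable_fun_sum s fun i _ => (hev i).const_mul (a i)).aemeasurable (by fun_prop),
      Finset.prod_apply] at h2
    have h4 : ∫ q, Complex.exp (Complex.I * ((∑ i ∈ s, a i • X i : Lp ℝ 2 P) q : ℂ)) ∂P
        = ∫ q : w → ℝ, Complex.exp (((1 : ℝ) : ℂ) * ((∑ i ∈ s, a i * q i : ℝ) : ℂ) *
            Complex.I) ∂P := by
      refine integral_congr_ae ?_
      filter_upwards [h3] with q hq
      rw [hq]; push_cast; ring_nf
    rw [h4, h2]
    push_cast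
    rw [Finset.mul_sum, Complex.exp_sum]
    refine Finset.prod_congr rfl fun i _ => ?_
    have h5 : P.map (fun q : w → ℝ => a i * q i)
        = (gaussianReal 0 1).map (fun x => a i * x) := by
      rw [← hlaw i, Measure.map_map (by fun_prop) (hev i)]; rfl
    rw [h5, gaussianReal_map_const_mul, charFun_gaussianReal]
    congr 1
    push_cast
    simp
    ring
  have hlim1 : Tendsto (fun s : Finset w =>
      ∫ q, Complex.exp (Complex.I * ((∑ i ∈ s, a i • X i : Lp ℝ 2 P) q : ℂ)) ∂P) atTop
      (𝓝 (∫ q, Complex.exp (Complex.I * (L (b.repr h) q : ℂ)) ∂P)) := by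
    rw [tendsto_iff_norm_sub_tendsto_zero]
    refine squeeze_zero (fun _ => norm_nonneg _) (fun s => norm_integral_exp_sub_le P _ _) ?_
    exact tendsto_iff_norm_sub_tendsto_zero.1 hsum
  have hlim2 : Tendsto (fun s : Finset w =>
      Complex.exp (-(1 / 2) * ((∑ i ∈ s, (a i) ^ 2 : ℝ) : ℂ))) atTop
      (𝓝 (Complex.exp (-(1 / 2) * ((‖h‖ ^ 2 : ℝ) : ℂ)))) := by
    have hc : Continuous fun r : ℝ => Complex.exp (-(1 / 2) * (r : ℂ)) := by fun_prop
    exact (hc.tendsto _).comp hnorm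
  simp_rw [hfin] at hlim1
  exact tendsto_nhds_unique hlim1 hlim2

/-- For every mass and inverse temperature the thermal time-zero field has a realization. -/
theorem ThermalField.exists_realization {m β : ℝ} (hm : 0 < m) (hβ : 0 < β) :
    ∃ (Q : Type) (_ : MeasurableSpace Q) (μ : Measure Q) (_ : IsProbabilityMeasure μ),
      Nonempty (ThermalField m β μ) := by
  obtain ⟨Q, mQ, P, hP, J, hJ⟩ := exists_isonormal OneParticle
  have hpos : ∀ k, 0 < Real.exp (β * energy m k) - 1 := fun k => by
    have := Real.add_one_le_exp (β * energy m k)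
    have := mul_pos hβ (energy_pos hm k)
    linarith
  have hρ0 : ∀ k, 0 ≤ thermalDensity m β k := fun k => inv_nonneg.2 (hpos k).le
  have hm1 : 0 < Real.exp (β * m) - 1 := by
    have := Real.add_one_le_exp (β * m)
    have := mul_pos hβ hm
    linarith
  have hρ1 : ∀ k, thermalDensity m β k ≤ (Real.exp (β * m) - 1)⁻¹ := fun k => by
    refine inv_anti₀ hm1 ?_
    have := Real.exp_le_exp.2 (mul_le_mul_of_nonneg_left (le_energy m k) hβ.le)
    linarith
  have hρc : Continuous (thermalDensity m β) := by
    unfold thermalDensity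
    have := continuous_energy m
    exact Continuous.inv₀ (by fun_prop) fun k => (hpos k).ne'
  -- multiplication by the square root of half of `1 + 2ρ`
  let t : ℝ → ℝ := fun k => Real.sqrt ((1 + 2 * thermalDensity m β k) / 2)
  have htc : Continuous t := by fun_prop
  have ht2 : ∀ k, t k ^ 2 = (1 + 2 * thermalDensity m β k) / 2 := fun k =>
    Real.sq_sqrt (by linarith [hρ0 k])
  have hmul : ∀ f : OneParticle, MemLp (fun k => t k • f k) 2 volume := by
    intro f
    refine (Lp.memLp f).of_le_mul
      (c := Real.sqrt ((1 + 2 * (Real.exp (β * m) - 1)⁻¹) / 2)) ?_ ?_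
    · exact htc.aestronglyMeasurable.smul (Lp.memLp f).1
    · refine Eventually.of_forall fun k => ?_
      rw [norm_smul, Real.norm_of_nonneg (Real.sqrt_nonneg _)]
      refine mul_le_mul_of_nonneg_right (Real.sqrt_le_sqrt ?_) (norm_nonneg _)
      linarith [hρ1 k]
  let T : OneParticle →ₗ[ℝ] OneParticle :=
    { toFun := fun f => (hmul f).toLp
      map_add' := by
        intro f g
        apply Lp.ext
        filter_upwards [(hmul (f + g)).coeFn_toLp, (hmul f).coeFn_toLp, (hmul g).coeFn_toLp,
          Lp.coeFn_add f g, Lp.coeFn_add (hmul f).toLp (hmul g).toLp] with k h1 h2 h3 h4 h5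
        rw [h1, h4, h5, Pi.add_apply, Pi.add_apply, h2, h3, smul_add]
      map_smul' := by
        intro r f
        apply Lp.ext
        filter_upwards [(hmul (r • f)).coeFn_toLp, (hmul f).coeFn_toLp,
          Lp.coeFn_smul r f, Lp.coeFn_smul r (hmul f).toLp] with k h1 h2 h3 h4
        simp only [RingHom.id_apply]
        rw [h1, h3, h4, Pi.smul_apply, Pi.smul_apply, h2, smul_comm] }
  let toL0 : Lp ℝ 2 P →ₗ[ℝ] (Q →ₘ[P] ℝ) :=
    { toFun := fun f => (f : Q →ₘ[P] ℝ)
      map_add' := fun _ _ => rfl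
      map_smul' := fun _ _ => rfl }
  refine ⟨Q, mQ, P, hP, ⟨⟨toL0 ∘ₗ J ∘ₗ T ∘ₗ realSubspace.subtype, fun f => ?_⟩⟩⟩
  have h := hJ (T f)
  refine h.trans ?_
  have hn : ‖T f‖ ^ 2
      = (1 / 2) * ∫ k : ℝ, (1 + 2 * thermalDensity m β k) * ‖(f : OneParticle) k‖ ^ 2 := by
    rw [← real_inner_self_eq_norm_sq, L2.inner_def, ← integral_const_mul]
    refine integral_congr_ae ?_
    filter_upwards [(hmul f).coeFn_toLp] with k hk
    change inner ℝ ((hmul f).toLp _ k) ((hmul f).toLp _ k) = _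
    rw [hk, real_inner_self_eq_norm_sq, norm_smul, mul_pow, Real.norm_eq_abs, sq_abs, ht2]
    ring
  rw [hn]
  congr 1
  push_cast
  ring

/-! ### Ultraviolet cutoff -/

/-- A real `χ ∈ C₀^∞(ℝ)` with `∫ χ = 1`. -/
structure UVCutoff where
  /-- the cutoff function -/
  toFun : ℝ → ℝ
  smooth : ContDiff ℝ ∞ toFun
  compactSupport : HasCompactSupport toFun
  integral_eq_one : ∫ y, toFun y = 1

/-- `χ̂(k) = ∫ e^{-iky} χ(y) dy`, so that `χ̂(0) = 1`. -/
def UVCutoff.hat (χ : UVCutoff) (k : ℝ) : ℂ :=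
  ∫ y : ℝ, Complex.exp (-(Complex.I * k * y)) * (χ.toFun y : ℂ)

/-- The function `f_{Λ,x}(k) = (4π)^{-1/2} e^{-ikx} χ̂(k/Λ) ε(k)^{-1/2}`. -/
def cutoffFun (m : ℝ) (χ : UVCutoff) (Λ x k : ℝ) : ℂ :=
  ((1 / Real.sqrt (4 * Real.pi) : ℝ) : ℂ) * Complex.exp (-(Complex.I * k * x)) *
    χ.hat (k / Λ) * (((energy m k) ^ (-(1 / 2) : ℝ) : ℝ) : ℂ)

/-- Up to scaling, `k ↦ χ̂(k/Λ)` is the Fourier transform of a Schwartz function. -/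
theorem UVCutoff.exists_schwartz (χ : UVCutoff) {Λ : ℝ} (hΛ : 0 < Λ) :
    ∃ S : SchwartzMap ℝ ℂ, ∀ k, S k = χ.hat (k / Λ) := by
  have hs : HasCompactSupport (fun y => (χ.toFun y : ℂ)) :=
    χ.compactSupport.comp_left (g := fun r : ℝ => (r : ℂ)) (by simp)
  have hc : ContDiff ℝ ∞ (fun y => (χ.toFun y : ℂ)) :=
    Complex.ofRealCLM.contDiff.comp χ.smooth
  have hne : (2 * Real.pi * Λ)⁻¹ ≠ 0 := by positivity
  let e : ℝ ≃L[ℝ] ℝ := ContinuousLinearEquiv.unitsEquivAut ℝ (Units.mk0 _ hne)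
  refine ⟨SchwartzMap.compCLMOfContinuousLinearEquiv ℂ e
    (FourierTransform.fourier (hs.toSchwartzMap hc)), fun k => ?_⟩
  rw [SchwartzMap.compCLMOfContinuousLinearEquiv_apply, Function.comp_apply,
    SchwartzMap.fourier_coe, Real.fourier_real_eq_integral_exp_smul]
  unfold UVCutoff.hat
  refine integral_congr_ae (Eventually.of_forall fun y => ?_)
  have he : e k = k * (2 * Real.pi * Λ)⁻¹ := by
    simp [e, ContinuousLinearEquiv.unitsEquivAut_apply]
  have hpi : (Real.pi : ℂ) ≠ 0 := by exact_mod_cast Real.pi_ne_zero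
  have hL : (Λ : ℂ) ≠ 0 := by exact_mod_cast hΛ.ne'
  simp only [HasCompactSupport.toSchwartzMap_toFun, smul_eq_mul, he]
  congr 2
  push_cast
  field_simp

theorem memLp_cutoffFun {m : ℝ} (hm : 0 < m) (χ : UVCutoff) {Λ : ℝ} (hΛ : 0 < Λ) (x : ℝ) :
    MemLp (cutoffFun m χ Λ x) 2 volume := by
  obtain ⟨S, hS⟩ := χ.exists_schwartz hΛ
  have hf : cutoffFun m χ Λ x = fun k : ℝ =>
      ((1 / Real.sqrt (4 * Real.pi) : ℝ) : ℂ) * Complex.exp (-(Complex.I * k * x)) *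
        S k * (((energy m k) ^ (-(1 / 2) : ℝ) : ℝ) : ℂ) := by
    funext k; rw [hS]; rfl
  rw [hf]
  refine (S.memLp 2 volume).of_le_mul
    (c := (1 / Real.sqrt (4 * Real.pi)) * m ^ (-(1 / 2) : ℝ)) ?_ ?_
  · have h1 : Continuous fun k : ℝ => (energy m k) ^ (-(1 / 2) : ℝ) :=
      (continuous_energy m).rpow_const fun k => Or.inl (energy_pos hm k).ne'
    have h2 : Continuous S := S.continuous
    exact (by fun_prop : Continuous _).aestronglyMeasurable
  · refine Eventually.of_forall fun k => ?_
    have hexp : ‖Complex.exp (-(Complex.I * k * x))‖ = 1 := by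
      rw [Complex.norm_exp]; simp
    have h0 : (energy m k) ^ (-(1 / 2) : ℝ) ≤ m ^ (-(1 / 2) : ℝ) :=
      Real.rpow_le_rpow_of_nonpos hm (le_energy m k) (by norm_num)
    have h3 : 0 ≤ (energy m k) ^ (-(1 / 2) : ℝ) := (Real.rpow_pos_of_pos (energy_pos hm k) _).le
    rw [norm_mul, norm_mul, norm_mul, hexp, Complex.norm_real, Complex.norm_real,
      Real.norm_of_nonneg h3, Real.norm_of_nonneg (by positivity)]
    have : 0 ≤ 1 / Real.sqrt (4 * Real.pi) * ‖S k‖ := by positivity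
    nlinarith [mul_le_mul_of_nonneg_left h0 this]

theorem UVCutoff.hat_neg (χ : UVCutoff) (k : ℝ) : χ.hat (-k) = star (χ.hat k) := by
  have h : star (χ.hat k) = (starRingEnd ℂ) (χ.hat k) := rfl
  rw [h]
  unfold UVCutoff.hat
  rw [← integral_conj]
  refine integral_congr_ae (Eventually.of_forall fun y => ?_)
  simp [← Complex.exp_conj]

theorem cutoffFun_neg (m : ℝ) (χ : UVCutoff) (Λ x k : ℝ) :
    cutoffFun m χ Λ x (-k) = star (cutoffFun m χ Λ x k) := by
  have he : energy m (-k) = energy m k := by unfold energy; simp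
  have h : ∀ z : ℂ, star z = (starRingEnd ℂ) z := fun _ => rfl
  unfold cutoffFun
  rw [neg_div, χ.hat_neg, he]
  simp only [h, map_mul, Complex.conj_ofReal, ← Complex.exp_conj]
  simp

/-- `f_{Λ,x}` as an element of `𝔥_κ`, for `Λ ∈ [1, ∞)`. -/
def cutoffVec {m : ℝ} (hm : 0 < m) (χ : UVCutoff) (Λ : Set.Ici (1 : ℝ)) (x : ℝ) : realSubspace :=
  ⟨(memLp_cutoffFun hm χ (zero_lt_one.trans_le Λ.2) x).toLp, by
    have hneg : Measure.QuasiMeasurePreserving (fun k : ℝ => -k) volume volume :=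
      (Measure.measurePreserving_neg (volume : Measure ℝ)).quasiMeasurePreserving
    have h1 := (memLp_cutoffFun hm χ (zero_lt_one.trans_le Λ.2) x).coeFn_toLp
    have h2 := hneg.ae h1
    change ∀ᵐ k : ℝ, _ = _
    filter_upwards [h1, h2] with k a b
    rw [a, b, cutoffFun_neg]⟩

/-! ### Wick-ordered exponentials and the cutoff interaction -/

section Wick

variable {m β : ℝ} {Q : Type*} [MeasurableSpace Q] {μ : Measure Q}

/-- The Wick-ordered exponential `:e^{α φ_ω(f)}:_c = e^{α φ_ω(f)} e^{-α² c(f, f) / 2}` with respect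
to the covariance `c`, as a function on `Q`. -/
def wickExpFun (φ : ThermalField m β μ) (c : realSubspace → ℝ) (α : ℝ) (f : realSubspace)
    (q : Q) : ℝ :=
  Real.exp (α * φ.field f q) * Real.exp (-(α ^ 2 / 2) * c f)

theorem covBeta_nonneg (hm : 0 < m) (hβ : 0 < β) (f : realSubspace) : 0 ≤ covBeta m β f := by
  unfold covBeta
  refine mul_nonneg (by norm_num) (integral_nonneg fun k => ?_)
  have h1 : 0 ≤ thermalDensity m β k := by
    unfold thermalDensity
    have := Real.add_one_le_exp (β * energy m k)
    have h2 := mul_pos hβ (energy_pos hm k)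
    exact inv_nonneg.2 (by linarith)
  have h3 : 0 ≤ 1 + 2 * thermalDensity m β k := by linarith
  exact mul_nonneg h3 (by positivity)

/-- `φ_ω(f)` is a centred Gaussian random variable of variance `c_β(f, f)`. -/
theorem ThermalField.map_field [IsProbabilityMeasure μ] (hm : 0 < m) (hβ : 0 < β)
    (φ : ThermalField m β μ) (f : realSubspace) :
    μ.map (φ.field f) = gaussianReal 0 (covBeta m β f).toNNReal := by
  have hmeas : AEMeasurable (φ.field f) μ := (φ.field f).aestronglyMeasurable.aemeasurable
  have : IsProbabilityMeasure (μ.map (φ.field f)) := Measure.isProbabilityMeasure_map hmeas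
  refine Measure.ext_of_charFun ?_
  funext t
  rw [charFun_gaussianReal, charFun_apply_real,
    integral_map hmeas (by fun_prop)]
  have h1 := φ.expectation_weyl (t • f)
  have h2 : (φ.field (t • f) : Q → ℝ) =ᵐ[μ] fun q => t * φ.field f q := by
    rw [map_smul]
    exact AEEqFun.coeFn_smul t (φ.field f)
  have h3 : ∫ q, Complex.exp (t * (φ.field f q : ℂ) * Complex.I) ∂μ
      = ∫ q, Complex.exp (Complex.I * (φ.field (t • f) q : ℂ)) ∂μ := by
    refine integral_congr_ae ?_
    filter_upwards [h2] with q hq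
    rw [hq]; push_cast; ring_nf
  have h4 : ∫ k : ℝ, (1 + 2 * thermalDensity m β k) * ‖((t • f : realSubspace) : OneParticle) k‖ ^ 2
      = t ^ 2 * ∫ k : ℝ, (1 + 2 * thermalDensity m β k) * ‖(f : OneParticle) k‖ ^ 2 := by
    rw [← integral_const_mul]
    refine integral_congr_ae ?_
    have h5 : (((t • f : realSubspace) : OneParticle) : ℝ → ℂ)
        =ᵐ[volume] t • ((f : OneParticle) : ℝ → ℂ) := Lp.coeFn_smul t (f : OneParticle)
    filter_upwards [h5] with k hk
    rw [hk, Pi.smul_apply, norm_smul, mul_pow, Real.norm_eq_abs, sq_abs]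
    ring
  rw [h3, h1, h4]
  congr 1
  rw [Real.coe_toNNReal _ (covBeta_nonneg hm hβ f)]
  unfold covBeta
  push_cast
  ring

theorem memLp_wickExpFun [IsProbabilityMeasure μ] (hm : 0 < m) (hβ : 0 < β)
    (φ : ThermalField m β μ) (c : realSubspace → ℝ) (α : ℝ) (f : realSubspace) :
    MemLp (wickExpFun φ c α f) 2 μ := by
  have hmeas : AEMeasurable (φ.field f) μ := (φ.field f).aestronglyMeasurable.aemeasurable
  have h1 : MemLp (fun q => Real.exp (α * φ.field f q)) 2 μ := by
    have hm1 : AEStronglyMeasurable (fun q => Real.exp (α * φ.field f q)) μ :=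
      (Real.measurable_exp.comp_aemeasurable (hmeas.const_mul α)).aestronglyMeasurable
    rw [memLp_two_iff_integrable_sq hm1]
    have h2 : Integrable (fun x : ℝ => Real.exp (2 * α * x)) (μ.map (φ.field f)) := by
      rw [φ.map_field hm hβ f]
      exact integrable_exp_mul_gaussianReal _
    have h3 := h2.comp_aemeasurable hmeas
    refine h3.congr (Eventually.of_forall fun q => ?_)
    simp only [Function.comp_apply]
    rw [← Real.exp_nat_mul]
    push_cast
    ring_nf
  exact h1.mul_const _

/-- `:e^{α φ_ω(f)}:_c` as an element of `L²(Q, Σ₀, μ)`. -/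
def wickExp [IsProbabilityMeasure μ] (hm : 0 < m) (hβ : 0 < β) (φ : ThermalField m β μ)
    (c : realSubspace → ℝ) (α : ℝ) (f : realSubspace) : Lp ℝ 2 μ :=
  (memLp_wickExpFun hm hβ φ c α f).toLp

/-- `:e^{α φ_Λ(x)}:_c ∈ L²(Q, Σ₀, μ)`, where `φ_Λ(x) = √2 φ_ω(f_{Λ,x}) = φ_ω(√2 f_{Λ,x})`. -/
def wickExpCutoff [IsProbabilityMeasure μ] (hm : 0 < m) (hβ : 0 < β) (φ : ThermalField m β μ)
    (c : realSubspace → ℝ) (χ : UVCutoff) (α : ℝ) (Λ : Set.Ici (1 : ℝ)) (x : ℝ) : Lp ℝ 2 μ :=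
  wickExp hm hβ φ c α (Real.sqrt 2 • cutoffVec hm χ Λ x)

/-- The cutoff interaction `∫ g(x) :e^{α φ_Λ(x)}:_c dx`, an `L²(Q, Σ₀, μ)`-valued integral. -/
def interaction [IsProbabilityMeasure μ] (hm : 0 < m) (hβ : 0 < β) (φ : ThermalField m β μ)
    (c : realSubspace → ℝ) (χ : UVCutoff) (g : ℝ → ℝ) (α : ℝ) (Λ : Set.Ici (1 : ℝ)) : Lp ℝ 2 μ :=
  ∫ x : ℝ, g x • wickExpCutoff hm hβ φ c χ α Λ x

end Wick

end

end HoeghKrohn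

namespace HoeghKrohn

/-! ### Bounds for the ultraviolet cutoff in momentum space -/

section Cutoff

/-! Everything reduces to the convergence of `⟨V_Λ, V_Λ'⟩` as `Λ` and `Λ'` tend to infinity
independently: if the limit is `L`, then `‖V_Λ - V_Λ'‖²` tends to `L - 2L + L = 0`
(`cauchy_map_of_tendsto_inner`).

The field is Gaussian, so a product of two Wick exponentials is again an exponential of the field,
and its mean is explicit. The inner product at the points `x`, `y` is `exp(α² K(x - y))`, with `K =
covKernel` the covariance of the two cutoff fields, up to a factor that depends only on `Λ`, `Λ'`
and converges. This factor is the only trace of the choice of Wick ordering: the two covariances of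
`φ_Λ(x)` differ by a number `d Λ`, independent of `x` and convergent because the thermal weight
`2ρ/ε` is integrable (`exists_cov_cutoffVec_eq`). Hence `⟨V_Λ, V_Λ'⟩` is essentially the double
integral of `g(x) g(y) exp(α² K(x - y))` (`inner_interaction`), to which dominated convergence
applies.

Pointwise convergence of `K` for `x ≠ 0` (`exists_tendsto_covKernel`): the vacuum weight `1/ε` is
not integrable, but one integration by parts against `e^{-ikx}` replaces it by a weight of order
`ε⁻²`, uniformly in the cutoffs.

Domination (`exists_covKernel_le`, `exists_exp_covKernel_le`): only an upper bound on `K` is needed.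
Momenta up to order `1/|x|` contribute at most `(4π)⁻¹ · 2 log(1/|x|) + O(1)`, larger ones `O(1)` by
integration by parts. So `exp(α² K)` is at most a constant times `|x|^{-α²/2π}` near zero, which is
integrable exactly when `α² < 2π`. The coefficient of the logarithm must be sharp although `|χ̂|`
may exceed `1`, since `χ` may change sign; `UVCutoff.exists_symbol_bounds` is arranged for this. An
integrable function of `x - y` is integrable against `g(x) g(y)` because `g ∈ L²`; the constant part
of the majorant uses `g ∈ L¹`.

The limit is nonnegative because the nonnegative cone of `L²` is closed. -/

theorem UVCutoff.exists_schwartz_hat (χ : UVCutoff) : ∃ S : SchwartzMap ℝ ℂ, ⇑S = χ.hat := by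
  obtain ⟨S, hS⟩ := χ.exists_schwartz one_pos
  exact ⟨S, funext fun k => by rw [hS, div_one]⟩

theorem UVCutoff.hat_zero (χ : UVCutoff) : χ.hat 0 = 1 := by
  unfold UVCutoff.hat
  simp [integral_complex_ofReal, χ.integral_eq_one]

theorem UVCutoff.differentiable_hat (χ : UVCutoff) : Differentiable ℝ χ.hat := by
  obtain ⟨S, hS⟩ := χ.exists_schwartz_hat
  exact hS ▸ S.differentiable

theorem UVCutoff.continuous_hat (χ : UVCutoff) : Continuous χ.hat :=
  χ.differentiable_hat.continuous

theorem UVCutoff.continuous_deriv_hat (χ : UVCutoff) : Continuous (deriv χ.hat) := by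
  obtain ⟨S, hS⟩ := χ.exists_schwartz_hat
  rw [← hS]
  exact (SchwartzMap.derivCLM ℂ ℂ S).continuous

theorem UVCutoff.integrable_hat (χ : UVCutoff) : Integrable χ.hat := by
  obtain ⟨S, hS⟩ := χ.exists_schwartz_hat
  exact hS ▸ S.integrable

theorem _root_.SchwartzMap.exists_one_add_abs_mul_norm_le (S : SchwartzMap ℝ ℂ) :
    ∃ A : ℝ, 0 < A ∧ ∀ s, (1 + |s|) * ‖S s‖ ≤ A := by
  obtain ⟨C₀, h₀, hC₀⟩ := S.decay 0 0
  obtain ⟨C₁, h₁, hC₁⟩ := S.decay 1 0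
  refine ⟨C₀ + C₁, by positivity, fun s => ?_⟩
  have e₀ := hC₀ s
  have e₁ := hC₁ s
  simp only [pow_zero, one_mul, pow_one, norm_iteratedFDeriv_zero, Real.norm_eq_abs] at e₀ e₁
  linarith

/-- The quantitative properties of `χ̂` used for the bounds on the covariance. -/
theorem UVCutoff.exists_bounds (χ : UVCutoff) : ∃ A : ℝ, 0 < A ∧ ∀ s,
    ‖χ.hat s‖ ≤ A ∧ (1 + |s|) * ‖deriv χ.hat s‖ ≤ A ∧
      ‖χ.hat s‖ ^ 2 ≤ 1 + A * (|s| * (1 + s ^ 2)⁻¹) := by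
  obtain ⟨S, hS⟩ := χ.exists_schwartz_hat
  obtain ⟨A₀, hA₀, h₀⟩ := S.exists_one_add_abs_mul_norm_le
  obtain ⟨A₁, hA₁, h₁⟩ := (SchwartzMap.derivCLM ℂ ℂ S).exists_one_add_abs_mul_norm_le
  simp only [SchwartzMap.derivCLM_apply, hS] at h₀ h₁
  have hd : ∀ s, ‖deriv χ.hat s‖ ≤ A₁ := fun s => by
    nlinarith [h₁ s, norm_nonneg (deriv χ.hat s), abs_nonneg s,
      mul_nonneg (abs_nonneg s) (norm_nonneg (deriv χ.hat s))]
  have hb : ∀ s, ‖χ.hat s‖ ≤ A₀ := fun s => by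
    nlinarith [h₀ s, mul_nonneg (abs_nonneg s) (norm_nonneg (χ.hat s))]
  have hlip : ∀ s, ‖χ.hat s‖ ≤ 1 + A₁ * |s| := fun s => by
    have h := Convex.norm_image_sub_le_of_norm_deriv_le (f := χ.hat) (C := A₁)
      (fun x _ => χ.differentiable_hat x) (fun x _ => hd x) convex_univ
      (Set.mem_univ 0) (Set.mem_univ s)
    rw [χ.hat_zero, sub_zero, Real.norm_eq_abs] at h
    have h2 := norm_sub_norm_le (χ.hat s) 1
    rw [norm_one] at h2
    linarith
  refine ⟨A₀ + A₁ + 2 * (2 * A₁ + A₁ ^ 2) + 2 * A₀ ^ 2, by positivity, fun s =>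
    ⟨(hb s).trans (by nlinarith [sq_nonneg A₀, sq_nonneg A₁]),
      (h₁ s).trans (by nlinarith [sq_nonneg A₀, sq_nonneg A₁]), ?_⟩⟩
  have hs := abs_nonneg s
  have hp : 0 < 1 + s ^ 2 := by positivity
  have hn := norm_nonneg (χ.hat s)
  rw [← sub_le_iff_le_add', ← mul_assoc, ← div_eq_mul_inv, le_div_iff₀ hp, ← sq_abs s]
  -- Near the origin `χ̂(0) = 1` and the Lipschitz bound apply; for `|s| ≥ 1` decay gives `‖χ̂(s)‖²
  -- (1 + s²) ≤ 2 A₀² ≤ 2 A₀² |s|`.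
  rcases le_total |s| 1 with h | h
  · have e : ‖χ.hat s‖ ^ 2 - 1 ≤ (2 * A₁ + A₁ ^ 2) * |s| := by
      have : ‖χ.hat s‖ ^ 2 ≤ (1 + A₁ * |s|) ^ 2 := pow_le_pow_left₀ hn (hlip s) 2
      nlinarith [mul_le_mul_of_nonneg_left h (mul_nonneg (sq_nonneg A₁) hs)]
    have e2 : (‖χ.hat s‖ ^ 2 - 1) * (1 + |s| ^ 2) ≤ (2 * A₁ + A₁ ^ 2) * |s| * (1 + |s| ^ 2) :=
      mul_le_mul_of_nonneg_right e (by positivity)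
    have e3 : (2 * A₁ + A₁ ^ 2) * |s| * (1 + |s| ^ 2) ≤ (2 * A₁ + A₁ ^ 2) * |s| * 2 :=
      mul_le_mul_of_nonneg_left (by nlinarith) (by positivity)
    have e4 : 0 ≤ (A₀ + A₁ + 2 * A₀ ^ 2) * |s| := by positivity
    nlinarith
  · have e : |s| * ‖χ.hat s‖ ≤ A₀ := by nlinarith [h₀ s]
    have e1 : (|s| * ‖χ.hat s‖) ^ 2 ≤ A₀ ^ 2 := pow_le_pow_left₀ (by positivity) e 2
    have e2 : ‖χ.hat s‖ ^ 2 ≤ A₀ ^ 2 := pow_le_pow_left₀ hn (hb s) 2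
    have e3 : 2 * A₀ ^ 2 * 1 ≤ 2 * A₀ ^ 2 * |s| := mul_le_mul_of_nonneg_left h (by positivity)
    have e4 : 0 ≤ (A₀ + A₁ + 2 * (2 * A₁ + A₁ ^ 2)) * |s| := by positivity
    nlinarith [sq_nonneg |s|]

theorem UVCutoff.tendsto_hat_div (χ : UVCutoff) (k : ℝ) {ι : Type*} {l : Filter ι} {Λ : ι → ℝ}
    (hΛ : Tendsto Λ l atTop) : Tendsto (fun i => χ.hat (k / Λ i)) l (𝓝 1) := by
  rw [← χ.hat_zero]
  exact (χ.continuous_hat.tendsto 0).comp (hΛ.const_div_atTop k)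

/-- The product of two cutoffs in momentum space. -/
noncomputable def UVCutoff.symbol (χ : UVCutoff) (Λ Λ' k : ℝ) : ℂ :=
  χ.hat (k / Λ) * star (χ.hat (k / Λ'))

theorem UVCutoff.continuous_symbol (χ : UVCutoff) (Λ Λ' : ℝ) : Continuous (χ.symbol Λ Λ') := by
  have := χ.continuous_hat
  unfold UVCutoff.symbol
  fun_prop

theorem UVCutoff.tendsto_symbol (χ : UVCutoff) (k : ℝ) {ι : Type*} {l : Filter ι} {Λ Λ' : ι → ℝ}
    (hΛ : Tendsto Λ l atTop) (hΛ' : Tendsto Λ' l atTop) :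
    Tendsto (fun i => χ.symbol (Λ i) (Λ' i) k) l (𝓝 1) := by
  have := (χ.tendsto_hat_div k hΛ).mul (χ.tendsto_hat_div k hΛ').star
  simpa [UVCutoff.symbol] using this

theorem UVCutoff.differentiable_symbol (χ : UVCutoff) (Λ Λ' : ℝ) :
    Differentiable ℝ (χ.symbol Λ Λ') := by
  have h := χ.differentiable_hat
  have h1 : ∀ Λ : ℝ, Differentiable ℝ fun k : ℝ => χ.hat (k / Λ) := fun Λ =>
    h.comp (by fun_prop)
  exact (h1 Λ).mul ((h1 Λ').star)

theorem UVCutoff.deriv_symbol (χ : UVCutoff) (Λ Λ' k : ℝ) :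
    deriv (χ.symbol Λ Λ') k = (Λ : ℂ)⁻¹ * deriv χ.hat (k / Λ) * star (χ.hat (k / Λ')) +
      χ.hat (k / Λ) * star ((Λ' : ℂ)⁻¹ * deriv χ.hat (k / Λ')) := by
  have h1 : ∀ Λ : ℝ, HasDerivAt (fun k : ℝ => χ.hat (k / Λ)) ((Λ : ℂ)⁻¹ * deriv χ.hat (k / Λ)) k := by
    intro Λ
    have := (χ.differentiable_hat (k / Λ)).hasDerivAt.scomp k ((hasDerivAt_id k).div_const Λ)
    simpa [Function.comp_def] using this
  exact ((h1 Λ).mul (h1 Λ').star).deriv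

theorem UVCutoff.continuous_deriv_symbol (χ : UVCutoff) (Λ Λ' : ℝ) :
    Continuous (deriv (χ.symbol Λ Λ')) := by
  have h1 := χ.continuous_hat
  have h2 := χ.continuous_deriv_hat
  have : deriv (χ.symbol Λ Λ') = _ := funext (χ.deriv_symbol Λ Λ')
  rw [this]
  fun_prop

theorem UVCutoff.integrable_symbol (χ : UVCutoff) {Λ : ℝ} (hΛ : Λ ≠ 0) (Λ' : ℝ) :
    Integrable (χ.symbol Λ Λ') := by
  obtain ⟨A, -, hA⟩ := χ.exists_bounds
  have h := χ.continuous_hat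
  refine (χ.integrable_hat.comp_div hΛ).mul_bdd (c := A) ?_ (Eventually.of_forall fun k => ?_)
  · exact (by fun_prop : Continuous _).aestronglyMeasurable
  · rw [norm_star]; exact (hA _).1

/-- All constants are uniform in the cutoffs. The first two bounds produce `ε⁻²` majorants after
integration by parts. In the third the leading constant is exactly `1`, which preserves the
coefficient of the logarithm; the excess, once divided by `ε`, has bounded integral. -/
theorem UVCutoff.exists_symbol_bounds (χ : UVCutoff) : ∃ A : ℝ, 0 < A ∧
    ∀ Λ Λ' k : ℝ, 1 ≤ Λ → 1 ≤ Λ' → ‖χ.symbol Λ Λ' k‖ ≤ A ∧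
      (1 + |k|) * ‖deriv (χ.symbol Λ Λ') k‖ ≤ A ∧
      ‖χ.symbol Λ Λ' k‖ ≤ 1 + A * |k| * (Λ⁻¹ * (1 + (Λ⁻¹ * k) ^ 2)⁻¹) +
        A * |k| * (Λ'⁻¹ * (1 + (Λ'⁻¹ * k) ^ 2)⁻¹) := by
  obtain ⟨A, hA0, hA⟩ := χ.exists_bounds
  refine ⟨2 * A ^ 2 + A, by positivity, fun Λ Λ' k hΛ hΛ' => ?_⟩
  -- The factor `Λ⁻¹` from the chain rule is absorbed by `(1 + |k|) Λ⁻¹ ≤ 1 + |k/Λ|`, valid since `Λ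
  -- ≥ 1`.
  have hd : ∀ Λ : ℝ, 1 ≤ Λ → (1 + |k|) * ‖(Λ : ℂ)⁻¹ * deriv χ.hat (k / Λ)‖ ≤ A := by
    intro Λ hΛ
    have h0 : 0 < Λ := by linarith
    have h1 := (hA (k / Λ)).2.1
    rw [abs_div, abs_of_pos h0] at h1
    rw [norm_mul, norm_inv, Complex.norm_real, Real.norm_of_nonneg h0.le, ← mul_assoc]
    refine le_trans (mul_le_mul_of_nonneg_right ?_ (norm_nonneg _)) h1
    rw [add_mul, one_mul, div_eq_mul_inv]
    gcongr
    exact inv_le_one_of_one_le₀ hΛ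
  have hs : ‖χ.symbol Λ Λ' k‖ = ‖χ.hat (k / Λ)‖ * ‖χ.hat (k / Λ')‖ := by
    rw [UVCutoff.symbol, norm_mul, norm_star]
  have n1 := norm_nonneg (χ.hat (k / Λ))
  have n2 := norm_nonneg (χ.hat (k / Λ'))
  have b1 := (hA (k / Λ)).1
  have b2 := (hA (k / Λ')).1
  refine ⟨?_, ?_, ?_⟩
  · rw [hs]
    nlinarith [mul_le_mul b1 b2 n2 hA0.le]
  · rw [χ.deriv_symbol]
    calc (1 + |k|) * ‖(Λ : ℂ)⁻¹ * deriv χ.hat (k / Λ) * star (χ.hat (k / Λ')) +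
          χ.hat (k / Λ) * star ((Λ' : ℂ)⁻¹ * deriv χ.hat (k / Λ'))‖
        ≤ (1 + |k|) * (‖(Λ : ℂ)⁻¹ * deriv χ.hat (k / Λ)‖ * ‖χ.hat (k / Λ')‖ +
          ‖χ.hat (k / Λ)‖ * ‖(Λ' : ℂ)⁻¹ * deriv χ.hat (k / Λ')‖) := by
          gcongr
          refine (norm_add_le _ _).trans (le_of_eq ?_)
          rw [norm_mul _ (star _), norm_mul (χ.hat _), norm_star, norm_star]
      _ = ((1 + |k|) * ‖(Λ : ℂ)⁻¹ * deriv χ.hat (k / Λ)‖) * ‖χ.hat (k / Λ')‖ +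
          ‖χ.hat (k / Λ)‖ * ((1 + |k|) * ‖(Λ' : ℂ)⁻¹ * deriv χ.hat (k / Λ')‖) := by ring
      _ ≤ A * A + A * A := by
          gcongr
          · exact hd Λ hΛ
          · exact hd Λ' hΛ'
      _ ≤ 2 * A ^ 2 + A := by nlinarith
  -- The product of the two norms is at most the mean of their squares, which separates `Λ` from
  -- `Λ'`.
  · have e : ∀ Λ : ℝ, 1 ≤ Λ →
        ‖χ.hat (k / Λ)‖ ^ 2 ≤ 1 + A * |k| * (Λ⁻¹ * (1 + (Λ⁻¹ * k) ^ 2)⁻¹) := by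
      intro Λ hΛ
      have h0 : 0 < Λ := by linarith
      refine (hA (k / Λ)).2.2.trans (le_of_eq ?_)
      rw [abs_div, abs_of_pos h0]
      ring_nf
    have e1 := e Λ hΛ
    have e2 := e Λ' hΛ'
    have p : ∀ Λ : ℝ, 1 ≤ Λ → 0 ≤ |k| * (Λ⁻¹ * (1 + (Λ⁻¹ * k) ^ 2)⁻¹) := fun Λ hΛ => by
      have h0 : 0 < Λ := by linarith
      positivity
    have p1 := mul_nonneg (by positivity : 0 ≤ 2 * A ^ 2 + A / 2) (p Λ hΛ)
    have p2 := mul_nonneg (by positivity : 0 ≤ 2 * A ^ 2 + A / 2) (p Λ' hΛ')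
    rw [hs]
    nlinarith [sq_nonneg (‖χ.hat (k / Λ)‖ - ‖χ.hat (k / Λ')‖)]

end Cutoff

/-! ### The covariance of the cutoff field -/

section Covariance

theorem integrable_mul_inv_one_add_sq {a : ℝ} (ha : 0 < a) :
    Integrable fun k : ℝ => a * (1 + (a * k) ^ 2)⁻¹ :=
  (integrable_inv_one_add_sq.comp_mul_left' ha.ne').const_mul a

/-- The mass does not depend on the scale `a`. Taken at `a = Λ⁻¹` and at `a = |x|`, this makes the
error terms uniform in the cutoffs and in the position. -/
theorem integral_mul_inv_one_add_sq {a : ℝ} (ha : 0 < a) :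
    ∫ k : ℝ, a * (1 + (a * k) ^ 2)⁻¹ = Real.pi := by
  rw [integral_const_mul, Measure.integral_comp_mul_left (fun k : ℝ => (1 + k ^ 2)⁻¹) a,
    integral_univ_inv_one_add_sq, abs_of_pos (inv_pos.2 ha), smul_eq_mul, ← mul_assoc,
    mul_inv_cancel₀ ha.ne', one_mul]

theorem norm_exp_neg_I_mul (k x : ℝ) : ‖Complex.exp (-(Complex.I * k * x))‖ = 1 := by
  rw [Complex.norm_exp]; simp

theorem integrable_exp_neg_I_mul {G : ℝ → ℂ} (hG : Integrable G) (x : ℝ) :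
    Integrable fun k : ℝ => Complex.exp (-(Complex.I * k * x)) * G k := by
  refine hG.bdd_mul (c := 1) ?_ (Eventually.of_forall fun k => (norm_exp_neg_I_mul k x).le)
  exact (by fun_prop : Continuous _).aestronglyMeasurable

theorem norm_integral_exp_neg_I_mul_le (G : ℝ → ℂ) (x : ℝ) :
    ‖∫ k : ℝ, Complex.exp (-(Complex.I * k * x)) * G k‖ ≤ ∫ k : ℝ, ‖G k‖ := by
  refine (norm_integral_le_integral_norm _).trans (le_of_eq ?_)
  simp_rw [norm_mul, norm_exp_neg_I_mul, one_mul]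

/-- Integration by parts against an oscillating exponential. -/
theorem integral_exp_neg_I_mul_deriv {G G' : ℝ → ℂ} (hG : ∀ k, HasDerivAt G (G' k) k)
    (hi : Integrable G) (hi' : Integrable G') (x : ℝ) :
    Complex.I * x * ∫ k : ℝ, Complex.exp (-(Complex.I * k * x)) * G k
      = ∫ k : ℝ, Complex.exp (-(Complex.I * k * x)) * G' k := by
  have h1 := integrable_exp_neg_I_mul hi x
  have h2 := integrable_exp_neg_I_mul hi' x
  have hd : ∀ k : ℝ, HasDerivAt (fun k : ℝ => Complex.exp (-(Complex.I * k * x)) * G k)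
      (Complex.exp (-(Complex.I * k * x)) * G' k -
        Complex.I * x * (Complex.exp (-(Complex.I * k * x)) * G k)) k := by
    intro k
    have e1 : HasDerivAt (fun k : ℝ => -(Complex.I * k * x)) (-(Complex.I * 1 * x)) k :=
      (((Complex.ofRealCLM.hasDerivAt (x := k)).const_mul Complex.I).mul_const (x : ℂ)).neg
    refine (e1.cexp.mul (hG k)).congr_deriv ?_
    ring
  have h := integral_eq_zero_of_hasDerivAt_of_integrable hd (h2.sub (h1.const_mul _))
    h1
  rw [integral_sub h2 (h1.const_mul _), integral_const_mul, sub_eq_zero] at h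
  exact h.symm

/-- Each factor `|x|` costs one derivative of the amplitude. This serves both for points with `|x| ≥
1` and for the high momenta when `|x| ≤ 1`. -/
theorem abs_mul_norm_integral_exp_neg_I_mul_le {G G' : ℝ → ℂ} (hG : ∀ k, HasDerivAt G (G' k) k)
    (hi : Integrable G) (hi' : Integrable G') (x : ℝ) :
    |x| * ‖∫ k : ℝ, Complex.exp (-(Complex.I * k * x)) * G k‖ ≤ ∫ k : ℝ, ‖G' k‖ := by
  have h := norm_integral_exp_neg_I_mul_le G' x
  rw [← integral_exp_neg_I_mul_deriv hG hi hi' x, norm_mul, norm_mul, Complex.norm_I, one_mul,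
    Complex.norm_real, Real.norm_eq_abs] at h
  exact h

/-! ### Estimates on the energy and the thermal density -/

variable {m β : ℝ}

theorem energy_sq (m k : ℝ) : energy m k ^ 2 = k ^ 2 + m ^ 2 := Real.sq_sqrt (by positivity)

theorem abs_le_energy (m k : ℝ) : |k| ≤ energy m k :=
  Real.abs_le_sqrt (by nlinarith [sq_nonneg m])

theorem abs_mul_inv_energy_le (hm : 0 < m) (k : ℝ) : |k| * (energy m k)⁻¹ ≤ 1 := by
  rw [← div_eq_mul_inv, div_le_one (energy_pos hm k)]
  exact abs_le_energy m k

theorem energy_le (hm : 0 < m) (k : ℝ) : energy m k ≤ (1 + m) * (1 + |k|) := by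
  refine Real.sqrt_le_iff.2 ⟨by positivity, ?_⟩
  rw [← sq_abs k]
  have := abs_nonneg k
  nlinarith [mul_nonneg hm.le this, mul_nonneg (mul_nonneg hm.le this) this, sq_nonneg (m * |k|)]

theorem integrable_inv_energy_sq (hm : 0 < m) : Integrable fun k => (energy m k ^ 2)⁻¹ := by
  refine ((integrable_mul_inv_one_add_sq (inv_pos.2 hm)).const_mul m⁻¹).congr
    (Eventually.of_forall fun k => ?_)
  simp only [energy_sq]
  field_simp
  ring

theorem hasDerivAt_inv_energy (hm : 0 < m) (k : ℝ) :
    HasDerivAt (fun k => (energy m k)⁻¹) (-(k * (energy m k ^ 3)⁻¹)) k := by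
  have hp := energy_pos hm k
  have h1 : HasDerivAt (fun k : ℝ => k ^ 2 + m ^ 2) (2 * k) k := by
    simpa using (hasDerivAt_pow 2 k).add_const (m ^ 2)
  have h2 : HasDerivAt (energy m) (2 * k / (2 * energy m k)) k :=
    h1.sqrt (by positivity)
  refine (h2.inv hp.ne').congr_deriv ?_
  field_simp

theorem thermalDensity_nonneg (hm : 0 < m) (hβ : 0 < β) (k : ℝ) : 0 ≤ thermalDensity m β k := by
  have := Real.add_one_le_exp (β * energy m k)
  have h2 := mul_pos hβ (energy_pos hm k)
  exact inv_nonneg.2 (by linarith)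

/-- From `e^t - 1 ≥ t`. The exponential decay of `ρ` is not needed: one more inverse power of `ε`
already makes the thermal weight integrable. -/
theorem thermalDensity_le (hm : 0 < m) (hβ : 0 < β) (k : ℝ) :
    thermalDensity m β k ≤ β⁻¹ * (energy m k)⁻¹ := by
  have := Real.add_one_le_exp (β * energy m k)
  have h2 := mul_pos hβ (energy_pos hm k)
  rw [← mul_inv]
  exact inv_anti₀ h2 (by linarith)

theorem continuous_inv_energy (hm : 0 < m) : Continuous fun k => (energy m k)⁻¹ :=
  (continuous_energy m).inv₀ fun k => (energy_pos hm k).ne'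

theorem continuous_thermalDensity (hm : 0 < m) (hβ : 0 < β) : Continuous (thermalDensity m β) := by
  have := continuous_energy m
  refine Continuous.inv₀ (by fun_prop) fun k => ?_
  have := Real.add_one_le_exp (β * energy m k)
  have h2 := mul_pos hβ (energy_pos hm k)
  linarith

/-- The thermal contribution to the one-particle weight decays like `ε⁻²`. -/
theorem thermal_weight_le (hm : 0 < m) (hβ : 0 < β) (k : ℝ) :
    2 * thermalDensity m β k * (energy m k)⁻¹ ≤ 2 * β⁻¹ * (energy m k ^ 2)⁻¹ := by
  have h := mul_le_mul_of_nonneg_right (thermalDensity_le hm hβ k)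
    (inv_nonneg.2 (energy_pos hm k).le)
  calc _ = 2 * (thermalDensity m β k * (energy m k)⁻¹) := by ring
    _ ≤ 2 * (β⁻¹ * (energy m k)⁻¹ * (energy m k)⁻¹) := by gcongr
    _ = _ := by ring

theorem thermal_weight_nonneg (hm : 0 < m) (hβ : 0 < β) (k : ℝ) :
    0 ≤ 2 * thermalDensity m β k * (energy m k)⁻¹ :=
  mul_nonneg (mul_nonneg zero_le_two (thermalDensity_nonneg hm hβ k))
    (inv_nonneg.2 (energy_pos hm k).le)

/-! ### The covariance kernel, its vacuum part and its thermal part -/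

variable (m β) in
/-- The covariance of the cutoff fields `φ_Λ`, `φ_Λ'` at two points with difference `x`. -/
noncomputable def covKernel (χ : UVCutoff) (Λ Λ' x : ℝ) : ℝ :=
  (4 * Real.pi)⁻¹ * (∫ k : ℝ, Complex.exp (-(Complex.I * k * x)) *
    (χ.symbol Λ Λ' k * (((1 + 2 * thermalDensity m β k) * (energy m k)⁻¹ : ℝ) : ℂ))).re

/-- The temperature-zero part of the integrand of `covKernel`. -/
noncomputable def vacuumWeight (m : ℝ) (χ : UVCutoff) (Λ Λ' k : ℝ) : ℂ :=
  χ.symbol Λ Λ' k * (((energy m k)⁻¹ : ℝ) : ℂ)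

/-- The derivative of `vacuumWeight`. -/
noncomputable def vacuumWeightDeriv (m : ℝ) (χ : UVCutoff) (Λ Λ' k : ℝ) : ℂ :=
  deriv (χ.symbol Λ Λ') k * (((energy m k)⁻¹ : ℝ) : ℂ) +
    χ.symbol Λ Λ' k * ((-(k * (energy m k ^ 3)⁻¹) : ℝ) : ℂ)

theorem hasDerivAt_vacuumWeight (hm : 0 < m) (χ : UVCutoff) (Λ Λ' k : ℝ) :
    HasDerivAt (vacuumWeight m χ Λ Λ') (vacuumWeightDeriv m χ Λ Λ' k) k :=
  (χ.differentiable_symbol Λ Λ' k).hasDerivAt.mul (hasDerivAt_inv_energy hm k).ofReal_comp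

theorem continuous_vacuumWeight (hm : 0 < m) (χ : UVCutoff) (Λ Λ' : ℝ) :
    Continuous (vacuumWeight m χ Λ Λ') := by
  have h1 := χ.continuous_symbol Λ Λ'
  have h2 := continuous_inv_energy hm
  unfold vacuumWeight
  fun_prop

theorem continuous_vacuumWeightDeriv (hm : 0 < m) (χ : UVCutoff) (Λ Λ' : ℝ) :
    Continuous (vacuumWeightDeriv m χ Λ Λ') := by
  have h1 := χ.continuous_symbol Λ Λ'
  have h2 := continuous_inv_energy hm
  have h3 := χ.continuous_deriv_symbol Λ Λ'
  unfold vacuumWeightDeriv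
  simp_rw [← inv_pow]
  fun_prop

theorem integrable_vacuumWeight (hm : 0 < m) (χ : UVCutoff) {Λ : ℝ} (hΛ : Λ ≠ 0) (Λ' : ℝ) :
    Integrable (vacuumWeight m χ Λ Λ') := by
  refine (χ.integrable_symbol hΛ Λ').mul_bdd (c := m⁻¹) ?_ (Eventually.of_forall fun k => ?_)
  · have h2 := continuous_inv_energy hm
    exact (by fun_prop : Continuous fun k => (((energy m k)⁻¹ : ℝ) : ℂ)).aestronglyMeasurable
  · rw [Complex.norm_real, Real.norm_of_nonneg (inv_nonneg.2 (energy_pos hm k).le)]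
    exact inv_anti₀ hm (le_energy m k)

/-- Differentiation gains a power of `ε`: the derivative of the symbol is at most `A / (1 + |k|) ≤ A
(1 + m) / ε`, and `(1/ε)' = -k/ε³` is at most `ε⁻²` in modulus. Their sum gives the constant `2 +
m`. -/
theorem norm_vacuumWeightDeriv_le (hm : 0 < m) {χ : UVCutoff} {A Λ Λ' k : ℝ}
    (h1 : ‖χ.symbol Λ Λ' k‖ ≤ A) (h2 : (1 + |k|) * ‖deriv (χ.symbol Λ Λ') k‖ ≤ A) :
    ‖vacuumWeightDeriv m χ Λ Λ' k‖ ≤ A * (2 + m) * (energy m k ^ 2)⁻¹ := by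
  have hp := energy_pos hm k
  have hA : 0 ≤ A := (norm_nonneg _).trans h1
  have e1 : ‖deriv (χ.symbol Λ Λ') k‖ ≤ A * (1 + m) * (energy m k)⁻¹ := by
    rw [← div_eq_mul_inv, le_div_iff₀ hp]
    calc _ ≤ ‖deriv (χ.symbol Λ Λ') k‖ * ((1 + m) * (1 + |k|)) := by
          gcongr; exact energy_le hm k
      _ = ((1 + |k|) * ‖deriv (χ.symbol Λ Λ') k‖) * (1 + m) := by ring
      _ ≤ A * (1 + m) := by gcongr
  have e2 : |k| * (energy m k ^ 3)⁻¹ ≤ (energy m k ^ 2)⁻¹ := by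
    calc _ = (|k| * (energy m k)⁻¹) * (energy m k ^ 2)⁻¹ := by ring
      _ ≤ 1 * (energy m k ^ 2)⁻¹ := by gcongr; exact abs_mul_inv_energy_le hm k
      _ = _ := one_mul _
  have n1 : ‖(((energy m k)⁻¹ : ℝ) : ℂ)‖ = (energy m k)⁻¹ := by
    rw [Complex.norm_real, Real.norm_of_nonneg (inv_nonneg.2 hp.le)]
  have n2 : ‖((-(k * (energy m k ^ 3)⁻¹) : ℝ) : ℂ)‖ = |k| * (energy m k ^ 3)⁻¹ := by
    rw [Complex.norm_real, norm_neg, norm_mul, Real.norm_eq_abs,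
      Real.norm_of_nonneg (by positivity)]
  unfold vacuumWeightDeriv
  calc _ ≤ ‖deriv (χ.symbol Λ Λ') k‖ * (energy m k)⁻¹ +
        ‖χ.symbol Λ Λ' k‖ * (|k| * (energy m k ^ 3)⁻¹) := by
        refine (norm_add_le _ _).trans ?_
        rw [norm_mul, norm_mul, n1, n2]
    _ ≤ A * (1 + m) * (energy m k)⁻¹ * (energy m k)⁻¹ + A * (energy m k ^ 2)⁻¹ := by
        gcongr
    _ = _ := by ring

theorem integrable_vacuumWeightDeriv (hm : 0 < m) (χ : UVCutoff) {Λ Λ' : ℝ} (hΛ : 1 ≤ Λ)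
    (hΛ' : 1 ≤ Λ') : Integrable (vacuumWeightDeriv m χ Λ Λ') := by
  obtain ⟨A, -, hA⟩ := χ.exists_symbol_bounds
  refine ((integrable_inv_energy_sq hm).const_mul (A * (2 + m))).mono'
    (continuous_vacuumWeightDeriv hm χ Λ Λ').aestronglyMeasurable
    (Eventually.of_forall fun k => ?_)
  exact norm_vacuumWeightDeriv_le hm (hA Λ Λ' k hΛ hΛ').1 (hA Λ Λ' k hΛ hΛ').2.1

theorem norm_symbol_mul_thermal_weight_le (hm : 0 < m) (hβ : 0 < β) {χ : UVCutoff} {A Λ Λ' k : ℝ}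
    (h1 : ‖χ.symbol Λ Λ' k‖ ≤ A) :
    ‖χ.symbol Λ Λ' k * ((2 * thermalDensity m β k * (energy m k)⁻¹ : ℝ) : ℂ)‖
      ≤ A * (2 * β⁻¹) * (energy m k ^ 2)⁻¹ := by
  have hA : 0 ≤ A := (norm_nonneg _).trans h1
  rw [norm_mul, Complex.norm_real, Real.norm_of_nonneg (thermal_weight_nonneg hm hβ k), mul_assoc A]
  exact mul_le_mul h1 (thermal_weight_le hm hβ k) (thermal_weight_nonneg hm hβ k) hA

theorem continuous_symbol_mul_thermal_weight (hm : 0 < m) (hβ : 0 < β) (χ : UVCutoff)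
    (Λ Λ' : ℝ) : Continuous fun k =>
      χ.symbol Λ Λ' k * ((2 * thermalDensity m β k * (energy m k)⁻¹ : ℝ) : ℂ) := by
  have h1 := χ.continuous_symbol Λ Λ'
  have h2 := continuous_inv_energy hm
  have h3 := continuous_thermalDensity hm hβ
  fun_prop

theorem integrable_symbol_mul_thermal_weight (hm : 0 < m) (hβ : 0 < β) (χ : UVCutoff)
    {Λ Λ' : ℝ} (hΛ : 1 ≤ Λ) (hΛ' : 1 ≤ Λ') : Integrable fun k =>
      χ.symbol Λ Λ' k * ((2 * thermalDensity m β k * (energy m k)⁻¹ : ℝ) : ℂ) := by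
  obtain ⟨A, -, hA⟩ := χ.exists_symbol_bounds
  refine ((integrable_inv_energy_sq hm).const_mul (A * (2 * β⁻¹))).mono'
    (continuous_symbol_mul_thermal_weight hm hβ χ Λ Λ').aestronglyMeasurable
    (Eventually.of_forall fun k => ?_)
  exact norm_symbol_mul_thermal_weight_le hm hβ (hA Λ Λ' k hΛ hΛ').1

/-- The two parts need different treatment: the thermal one has an integrable majorant uniform in
the cutoffs, while the vacuum one is controlled only through the oscillation of `e^{-ikx}`. -/
theorem covKernel_eq_add (hm : 0 < m) (hβ : 0 < β) (χ : UVCutoff) {Λ Λ' : ℝ} (hΛ : 1 ≤ Λ)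
    (hΛ' : 1 ≤ Λ') (x : ℝ) : covKernel m β χ Λ Λ' x = (4 * Real.pi)⁻¹ *
      ((∫ k : ℝ, Complex.exp (-(Complex.I * k * x)) * vacuumWeight m χ Λ Λ' k).re +
       (∫ k : ℝ, Complex.exp (-(Complex.I * k * x)) *
        (χ.symbol Λ Λ' k * ((2 * thermalDensity m β k * (energy m k)⁻¹ : ℝ) : ℂ))).re) := by
  rw [covKernel, ← Complex.add_re, ← integral_add
    (integrable_exp_neg_I_mul (integrable_vacuumWeight hm χ (by positivity) Λ') x)
    (integrable_exp_neg_I_mul (integrable_symbol_mul_thermal_weight hm hβ χ hΛ hΛ') x)]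
  congr 3
  funext k
  simp only [vacuumWeight]
  push_cast
  ring

theorem continuous_covKernel (hm : 0 < m) (hβ : 0 < β) (χ : UVCutoff) {Λ Λ' : ℝ} (hΛ : 1 ≤ Λ)
    (hΛ' : 1 ≤ Λ') : Continuous (covKernel m β χ Λ Λ') := by
  have h1 : ∀ G : ℝ → ℂ, Integrable G →
      Continuous fun x : ℝ => ∫ k : ℝ, Complex.exp (-(Complex.I * k * x)) * G k := fun G hG =>
    continuous_of_dominated (fun x => (integrable_exp_neg_I_mul hG x).1)
      (fun x => Eventually.of_forall fun k => by
        rw [norm_mul, norm_exp_neg_I_mul, one_mul]) hG.norm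
      (Eventually.of_forall fun k => by fun_prop)
  have e : covKernel m β χ Λ Λ' = _ := funext (covKernel_eq_add hm hβ χ hΛ hΛ')
  rw [e]
  exact ((Complex.continuous_re.comp
    (h1 _ (integrable_vacuumWeight hm χ (by positivity) Λ'))).add
    (Complex.continuous_re.comp
      (h1 _ (integrable_symbol_mul_thermal_weight hm hβ χ hΛ hΛ')))).const_mul _

theorem tendsto_deriv_symbol (χ : UVCutoff) (k : ℝ) {ι : Type*} {l : Filter ι} {Λ Λ' : ι → ℝ}
    (hΛ : Tendsto Λ l atTop) (hΛ' : Tendsto Λ' l atTop) :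
    Tendsto (fun i => deriv (χ.symbol (Λ i) (Λ' i)) k) l (𝓝 0) := by
  have h1 : ∀ Λ : ι → ℝ, Tendsto Λ l atTop →
      Tendsto (fun i => (Λ i : ℂ)⁻¹ * deriv χ.hat (k / Λ i)) l (𝓝 0) := fun Λ hΛ => by
    have e1 : Tendsto (fun i => (((Λ i)⁻¹ : ℝ) : ℂ)) l (𝓝 ((0 : ℝ) : ℂ)) :=
      (Complex.continuous_ofReal.tendsto 0).comp (tendsto_inv_atTop_zero.comp hΛ)
    have e2 := (χ.continuous_deriv_hat.tendsto 0).comp (hΛ.const_div_atTop k)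
    simpa using e1.mul e2
  have h2 := ((h1 Λ hΛ).mul (χ.tendsto_hat_div k hΛ').star).add
    ((χ.tendsto_hat_div k hΛ).mul (h1 Λ' hΛ').star)
  simp_rw [χ.deriv_symbol]
  simpa using h2

/-- Away from coinciding points the covariances of the cutoff fields converge. -/
theorem exists_tendsto_covKernel (hm : 0 < m) (hβ : 0 < β) (χ : UVCutoff) :
    ∃ C : ℝ → ℝ, ∀ x, x ≠ 0 → ∀ {ι : Type} {l : Filter ι} [l.IsCountablyGenerated]
      {Λ Λ' : ι → ℝ}, (∀ i, 1 ≤ Λ i) → (∀ i, 1 ≤ Λ' i) →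
      Tendsto Λ l atTop → Tendsto Λ' l atTop →
      Tendsto (fun i => covKernel m β χ (Λ i) (Λ' i) x) l (𝓝 (C x)) := by
  obtain ⟨A, hA0, hA⟩ := χ.exists_symbol_bounds
  -- The formal limit of the vacuum part would contain the non-integrable weight `1/ε`; the witness
  -- is its form after integration by parts.
  refine ⟨fun x => (4 * Real.pi)⁻¹ *
    (((Complex.I * x)⁻¹ * ∫ k : ℝ, Complex.exp (-(Complex.I * k * x)) *
        ((-(k * (energy m k ^ 3)⁻¹) : ℝ) : ℂ)).re +
     (∫ k : ℝ, Complex.exp (-(Complex.I * k * x)) *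
        ((2 * thermalDensity m β k * (energy m k)⁻¹ : ℝ) : ℂ)).re),
    fun x hx ι l _ Λ Λ' h1 h1' hΛ hΛ' => ?_⟩
  have hIx : Complex.I * (x : ℂ) ≠ 0 :=
    mul_ne_zero Complex.I_ne_zero (Complex.ofReal_ne_zero.2 hx)
  have e : ∀ i, ∫ k : ℝ, Complex.exp (-(Complex.I * k * x)) * vacuumWeight m χ (Λ i) (Λ' i) k
      = (Complex.I * x)⁻¹ * ∫ k : ℝ, Complex.exp (-(Complex.I * k * x)) *
          vacuumWeightDeriv m χ (Λ i) (Λ' i) k := fun i => by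
    rw [← integral_exp_neg_I_mul_deriv (hasDerivAt_vacuumWeight hm χ (Λ i) (Λ' i))
      (integrable_vacuumWeight hm χ (by linarith [h1 i]) _)
      (integrable_vacuumWeightDeriv hm χ (h1 i) (h1' i)) x, inv_mul_cancel_left₀ hIx]
  simp_rw [fun i => covKernel_eq_add hm hβ χ (h1 i) (h1' i) x, e]
  refine Tendsto.const_mul _ (((Complex.continuous_re.tendsto _).comp
    (Tendsto.const_mul _ ?_)).add ((Complex.continuous_re.tendsto _).comp ?_))
  · refine tendsto_integral_filter_of_dominated_convergence
      (fun k => A * (2 + m) * (energy m k ^ 2)⁻¹)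
      (Eventually.of_forall fun i => (integrable_exp_neg_I_mul
        (integrable_vacuumWeightDeriv hm χ (h1 i) (h1' i)) x).1)
      (Eventually.of_forall fun i => Eventually.of_forall fun k => ?_)
      ((integrable_inv_energy_sq hm).const_mul _) (Eventually.of_forall fun k => ?_)
    · rw [norm_mul, norm_exp_neg_I_mul, one_mul]
      exact norm_vacuumWeightDeriv_le hm (hA _ _ k (h1 i) (h1' i)).1 (hA _ _ k (h1 i) (h1' i)).2.1
    -- The derivative of the symbol tends to `0`, so only the derivative of `1/ε` survives.
    · refine Tendsto.const_mul _ ?_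
      have := ((tendsto_deriv_symbol χ k hΛ hΛ').mul_const (((energy m k)⁻¹ : ℝ) : ℂ)).add
        ((χ.tendsto_symbol k hΛ hΛ').mul_const ((-(k * (energy m k ^ 3)⁻¹) : ℝ) : ℂ))
      rwa [zero_mul, zero_add, one_mul] at this
  · refine tendsto_integral_filter_of_dominated_convergence
      (fun k => A * (2 * β⁻¹) * (energy m k ^ 2)⁻¹)
      (Eventually.of_forall fun i => (integrable_exp_neg_I_mul
        (integrable_symbol_mul_thermal_weight hm hβ χ (h1 i) (h1' i)) x).1)
      (Eventually.of_forall fun i => Eventually.of_forall fun k => ?_)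
      ((integrable_inv_energy_sq hm).const_mul _) (Eventually.of_forall fun k => ?_)
    · rw [norm_mul, norm_exp_neg_I_mul, one_mul]
      exact norm_symbol_mul_thermal_weight_le hm hβ (hA _ _ k (h1 i) (h1' i)).1
    · refine Tendsto.const_mul _ ?_
      have := (χ.tendsto_symbol k hΛ hΛ').mul_const
        ((2 * thermalDensity m β k * (energy m k)⁻¹ : ℝ) : ℂ)
      rwa [one_mul] at this

end Covariance

/-! ### The logarithmic bound on the covariance -/

section LogBound

variable {m β : ℝ}

theorem continuous_inv_one_add_mul_sq (a : ℝ) : Continuous fun k : ℝ => (1 + (a * k) ^ 2)⁻¹ :=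
  Continuous.inv₀ (by fun_prop) fun k => by positivity

/-- The integral of the vacuum weight, cut off at momenta of order `a⁻¹`, grows like `2 log a⁻¹`. -/
theorem integral_inv_energy_mul_le (hm : 0 < m) {a : ℝ} (ha : 0 < a) (ha1 : a ≤ 1) :
    Integrable (fun k => (energy m k)⁻¹ * (1 + (a * k) ^ 2)⁻¹) ∧
    ∫ k, (energy m k)⁻¹ * (1 + (a * k) ^ 2)⁻¹ ≤ 2 * m⁻¹ - 2 * Real.log a + Real.pi := by
  have ha' : 1 ≤ a⁻¹ := (one_le_inv₀ ha).2 ha1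
  -- Majorants by region: `1/m` for `|k| ≤ 1`; `1/|k|` for `1 ≤ |k| ≤ 1/a`, each half-line giving
  -- `-log a`; beyond that `1/ε ≤ a`, with total mass `π`.
  let u : ℝ → ℝ := (Set.Icc (-1) 1).indicator fun _ => m⁻¹
  let v : ℝ → ℝ := (Set.Icc 1 a⁻¹).indicator fun k => k⁻¹
  have hu : Integrable u :=
    (integrable_indicator_iff measurableSet_Icc).2 (integrableOn_const (by simp))
  have hv : Integrable v := by
    refine (integrable_indicator_iff measurableSet_Icc).2 (ContinuousOn.integrableOn_Icc ?_)
    exact continuousOn_inv₀.mono fun k hk => by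
      simpa using (zero_lt_one.trans_le hk.1).ne'
  have hu0 : ∀ k, 0 ≤ u k := fun k => Set.indicator_nonneg (fun _ _ => by positivity) k
  have hv0 : ∀ k, 0 ≤ v k := fun k => Set.indicator_nonneg
    (fun k hk => inv_nonneg.2 (zero_le_one.trans hk.1)) k
  have iu : ∫ k, u k = 2 * m⁻¹ := by
    rw [integral_indicator measurableSet_Icc]
    simp
    norm_num
  have iv : ∫ k, v k = -Real.log a := by
    rw [integral_indicator measurableSet_Icc, integral_Icc_eq_integral_Ioc,
      ← intervalIntegral.integral_of_le ha', integral_inv_of_pos one_pos (by positivity)]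
    simp
  have hb := ((hu.add hv).add hv.comp_neg).add (integrable_mul_inv_one_add_sq ha)
  have hle : ∀ k, (energy m k)⁻¹ * (1 + (a * k) ^ 2)⁻¹
      ≤ u k + v k + v (-k) + a * (1 + (a * k) ^ 2)⁻¹ := by
    intro k
    have hp := energy_pos hm k
    have hq : 0 ≤ (1 + (a * k) ^ 2)⁻¹ := by positivity
    have hq1 : (1 + (a * k) ^ 2)⁻¹ ≤ 1 := inv_le_one_of_one_le₀ (by nlinarith [sq_nonneg (a * k)])
    have h0 : (energy m k)⁻¹ * (1 + (a * k) ^ 2)⁻¹ ≤ (energy m k)⁻¹ :=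
      mul_le_of_le_one_right (by positivity) hq1
    have hr : 0 ≤ a * (1 + (a * k) ^ 2)⁻¹ := by positivity
    have hv1 : ∀ k, 1 ≤ k → k ≤ a⁻¹ → v k = k⁻¹ := fun k h1 h2 =>
      Set.indicator_of_mem (Set.mem_Icc.2 ⟨h1, h2⟩) _
    have hinv : ∀ t, 0 < t → t ≤ |k| → (energy m k)⁻¹ ≤ t⁻¹ := fun t ht h =>
      inv_anti₀ ht (h.trans (abs_le_energy m k))
    rcases le_or_gt |k| 1 with h1 | h1
    · have e : u k = m⁻¹ := Set.indicator_of_mem (Set.mem_Icc.2 (abs_le.1 h1)) _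
      have := inv_anti₀ hm (le_energy m k)
      linarith [hv0 k, hv0 (-k)]
    rcases le_or_gt |k| a⁻¹ with h2 | h2
    · rcases abs_cases k with ⟨e, -⟩ | ⟨e, -⟩
      · rw [e] at h1 h2
        linarith [hu0 k, hv0 (-k), hv1 k h1.le h2, hinv k (by linarith) e.ge]
      · rw [e] at h1 h2
        linarith [hu0 k, hv0 k, hv1 (-k) h1.le h2, hinv (-k) (by linarith) e.ge]
    · have e := hinv a⁻¹ (by positivity) h2.le
      rw [inv_inv] at e
      have := mul_le_mul_of_nonneg_right e hq
      linarith [hu0 k, hv0 k, hv0 (-k)]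
  have hn : ∀ k, 0 ≤ (energy m k)⁻¹ * (1 + (a * k) ^ 2)⁻¹ := fun k => by
    have := energy_pos hm k
    positivity
  have hi : Integrable fun k => (energy m k)⁻¹ * (1 + (a * k) ^ 2)⁻¹ := by
    refine hb.mono' ((continuous_inv_energy hm).mul
      (continuous_inv_one_add_mul_sq a)).aestronglyMeasurable (Eventually.of_forall fun k => ?_)
    rw [Real.norm_of_nonneg (hn k)]
    exact hle k
  refine ⟨hi, (integral_mono hi hb hle).trans (le_of_eq ?_)⟩
  have h1 := integral_add ((hu.add hv).add hv.comp_neg) (integrable_mul_inv_one_add_sq ha)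
  have h2 := integral_add (hu.add hv) hv.comp_neg
  have h3 := integral_add hu hv
  have h4 := integral_neg_eq_self v volume
  simp only [Pi.add_apply] at h1 h2 h3 ⊢
  rw [h1, h2, h3, h4, iu, iv, integral_mul_inv_one_add_sq ha]
  ring

theorem hasDerivAt_inv_one_add_mul_sq (x k : ℝ) :
    HasDerivAt (fun k : ℝ => 1 - (1 + (x * k) ^ 2)⁻¹)
      (2 * x ^ 2 * k * (1 + (x * k) ^ 2)⁻¹ ^ 2) k := by
  have h1 : HasDerivAt (fun k : ℝ => 1 + (x * k) ^ 2) (2 * x ^ 2 * k) k := by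
    refine ((((hasDerivAt_id k).const_mul x).pow 2).const_add 1).congr_deriv ?_
    simp
    ring
  refine ((h1.inv (by positivity : (1 + (x * k) ^ 2) ≠ 0)).const_sub 1).congr_deriv ?_
  field_simp

/-- The low-momentum part of the covariance. -/
theorem exists_integral_norm_vacuumWeight_mul_le (hm : 0 < m) (χ : UVCutoff) :
    ∃ B : ℝ, ∀ Λ Λ' a : ℝ, 1 ≤ Λ → 1 ≤ Λ' → 0 < a → a ≤ 1 →
      ∫ k, ‖vacuumWeight m χ Λ Λ' k * (((1 + (a * k) ^ 2)⁻¹ : ℝ) : ℂ)‖ ≤ B - 2 * Real.log a := by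
  obtain ⟨A, hA0, hA⟩ := χ.exists_symbol_bounds
  -- The leading `1` in the symbol bound gives `2/m + π` and the logarithm; the excess due to each
  -- cutoff gives `A π`, its factor `|k|` being absorbed by `1/ε`.
  refine ⟨2 * m⁻¹ + Real.pi + 2 * (A * Real.pi), fun Λ Λ' a hΛ hΛ' ha ha1 => ?_⟩
  obtain ⟨hi, hle⟩ := integral_inv_energy_mul_le hm ha ha1
  have i1 := integrable_mul_inv_one_add_sq (inv_pos.2 (zero_lt_one.trans_le hΛ))
  have i2 := integrable_mul_inv_one_add_sq (inv_pos.2 (zero_lt_one.trans_le hΛ'))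
  have hb := (hi.add (i1.const_mul A)).add (i2.const_mul A)
  have key : ∀ k, ‖vacuumWeight m χ Λ Λ' k * (((1 + (a * k) ^ 2)⁻¹ : ℝ) : ℂ)‖
      ≤ (energy m k)⁻¹ * (1 + (a * k) ^ 2)⁻¹ + A * (Λ⁻¹ * (1 + (Λ⁻¹ * k) ^ 2)⁻¹) +
        A * (Λ'⁻¹ * (1 + (Λ'⁻¹ * k) ^ 2)⁻¹) := by
    intro k
    have hp := energy_pos hm k
    have hq : 0 ≤ (1 + (a * k) ^ 2)⁻¹ := by positivity
    have hq1 : (1 + (a * k) ^ 2)⁻¹ ≤ 1 := inv_le_one_of_one_le₀ (by nlinarith [sq_nonneg (a * k)])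
    have n1 : ‖(((energy m k)⁻¹ : ℝ) : ℂ)‖ = (energy m k)⁻¹ := by
      rw [Complex.norm_real, Real.norm_of_nonneg (inv_nonneg.2 hp.le)]
    have n2 : ‖(((1 + (a * k) ^ 2)⁻¹ : ℝ) : ℂ)‖ = (1 + (a * k) ^ 2)⁻¹ := by
      rw [Complex.norm_real, Real.norm_of_nonneg hq]
    rw [norm_mul, vacuumWeight, norm_mul, n1, n2]
    have c1 : |k| * (energy m k)⁻¹ * (1 + (a * k) ^ 2)⁻¹ ≤ 1 :=
      mul_le_one₀ (abs_mul_inv_energy_le hm k) hq hq1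
    have hr : ∀ Λ : ℝ, 1 ≤ Λ → 0 ≤ A * (Λ⁻¹ * (1 + (Λ⁻¹ * k) ^ 2)⁻¹) := fun Λ h => by
      have : 0 < Λ := by linarith
      positivity
    calc _ ≤ (1 + A * |k| * (Λ⁻¹ * (1 + (Λ⁻¹ * k) ^ 2)⁻¹) +
          A * |k| * (Λ'⁻¹ * (1 + (Λ'⁻¹ * k) ^ 2)⁻¹)) * (energy m k)⁻¹ *
          (1 + (a * k) ^ 2)⁻¹ := by
          gcongr
          exact (hA Λ Λ' k hΛ hΛ').2.2
      _ = (energy m k)⁻¹ * (1 + (a * k) ^ 2)⁻¹ +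
          A * (Λ⁻¹ * (1 + (Λ⁻¹ * k) ^ 2)⁻¹) * (|k| * (energy m k)⁻¹ * (1 + (a * k) ^ 2)⁻¹) +
          A * (Λ'⁻¹ * (1 + (Λ'⁻¹ * k) ^ 2)⁻¹) *
            (|k| * (energy m k)⁻¹ * (1 + (a * k) ^ 2)⁻¹) := by ring
      _ ≤ _ := by
          exact add_le_add (add_le_add le_rfl (mul_le_of_le_one_right (hr Λ hΛ) c1))
            (mul_le_of_le_one_right (hr Λ' hΛ') c1)
  refine (integral_mono_of_nonneg (Eventually.of_forall fun k => norm_nonneg _) hb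
    (Eventually.of_forall key)).trans ?_
  have h1 := integral_add (hi.add (i1.const_mul A)) (i2.const_mul A)
  have h2 := integral_add hi (i1.const_mul A)
  simp only [Pi.add_apply] at h1 h2 ⊢
  rw [h1, h2, integral_const_mul A, integral_const_mul A,
    integral_mul_inv_one_add_sq (inv_pos.2 (zero_lt_one.trans_le hΛ)),
    integral_mul_inv_one_add_sq (inv_pos.2 (zero_lt_one.trans_le hΛ'))]
  linarith

/-- The high-momentum part of the covariance is bounded, by integration by parts. -/
theorem exists_norm_integral_vacuumWeight_high_le (hm : 0 < m) (χ : UVCutoff) :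
    ∃ B : ℝ, ∀ Λ Λ' x : ℝ, 1 ≤ Λ → 1 ≤ Λ' → x ≠ 0 →
      ‖∫ k : ℝ, Complex.exp (-(Complex.I * k * x)) *
        (vacuumWeight m χ Λ Λ' k * ((1 - (1 + (x * k) ^ 2)⁻¹ : ℝ) : ℂ))‖ ≤ B := by
  obtain ⟨A, hA0, hA⟩ := χ.exists_symbol_bounds
  refine ⟨(A * (2 + m) + 2 * A) * Real.pi, fun Λ Λ' x hΛ hΛ' hx => ?_⟩
  have hx' : 0 < |x| := abs_pos.2 hx
  let G : ℝ → ℂ := fun k => vacuumWeight m χ Λ Λ' k * ((1 - (1 + (x * k) ^ 2)⁻¹ : ℝ) : ℂ)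
  let G' : ℝ → ℂ := fun k => vacuumWeightDeriv m χ Λ Λ' k * ((1 - (1 + (x * k) ^ 2)⁻¹ : ℝ) : ℂ) +
    vacuumWeight m χ Λ Λ' k * ((2 * x ^ 2 * k * (1 + (x * k) ^ 2)⁻¹ ^ 2 : ℝ) : ℂ)
  have hG : ∀ k, HasDerivAt G (G' k) k := fun k =>
    (hasDerivAt_vacuumWeight hm χ Λ Λ' k).mul (hasDerivAt_inv_one_add_mul_sq x k).ofReal_comp
  have hq0 : ∀ k, 0 ≤ (1 + (x * k) ^ 2)⁻¹ := fun k => by positivity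
  have hq1 : ∀ k, (1 + (x * k) ^ 2)⁻¹ ≤ 1 := fun k =>
    inv_le_one_of_one_le₀ (by nlinarith [sq_nonneg (x * k)])
  have hc := continuous_inv_one_add_mul_sq x
  have hGi : Integrable G := by
    refine (integrable_vacuumWeight hm χ (by linarith) Λ').mul_bdd (c := 1) ?_
      (Eventually.of_forall fun k => ?_)
    · exact (Complex.continuous_ofReal.comp (continuous_const.sub hc)).aestronglyMeasurable
    · rw [Complex.norm_real, Real.norm_of_nonneg (by linarith [hq1 k])]
      linarith [hq0 k]
  have hGc : Continuous G' := by
    have h1 := continuous_vacuumWeight hm χ Λ Λ'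
    have h2 := continuous_vacuumWeightDeriv hm χ Λ Λ'
    exact (h2.mul (Complex.continuous_ofReal.comp (continuous_const.sub hc))).add
      (h1.mul (Complex.continuous_ofReal.comp (by fun_prop)))
  -- The factor `1 - (1 + (xk)²)⁻¹ = x² k² (1 + (xk)²)⁻¹` vanishes to second order at `k = 0` and
  -- compensates `ε⁻²`. What remains is `|x|` times a function of mass `π`, and this `|x|` cancels
  -- the one from integration by parts.
  have hbound : ∀ k, ‖G' k‖ ≤ (A * (2 + m) + 2 * A) * |x| * (|x| * (1 + (|x| * k) ^ 2)⁻¹) := by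
    intro k
    have hp := energy_pos hm k
    have habs : (|x| * k) ^ 2 = (x * k) ^ 2 := by rw [mul_pow, mul_pow, sq_abs]
    have e1 : ‖((1 - (1 + (x * k) ^ 2)⁻¹ : ℝ) : ℂ)‖ = x ^ 2 * k ^ 2 * (1 + (x * k) ^ 2)⁻¹ := by
      rw [Complex.norm_real, Real.norm_of_nonneg (by linarith [hq1 k])]
      field_simp
      ring
    have e2 : ‖((2 * x ^ 2 * k * (1 + (x * k) ^ 2)⁻¹ ^ 2 : ℝ) : ℂ)‖
        = 2 * x ^ 2 * |k| * (1 + (x * k) ^ 2)⁻¹ ^ 2 := by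
      rw [Complex.norm_real, norm_mul, norm_mul, Real.norm_eq_abs k,
        Real.norm_of_nonneg (by positivity), Real.norm_of_nonneg (by positivity)]
    have e3 : ‖vacuumWeight m χ Λ Λ' k‖ ≤ A * (energy m k)⁻¹ := by
      rw [vacuumWeight, norm_mul, Complex.norm_real,
        Real.norm_of_nonneg (inv_nonneg.2 hp.le)]
      gcongr
      exact (hA Λ Λ' k hΛ hΛ').1
    have e4 := norm_vacuumWeightDeriv_le hm (hA Λ Λ' k hΛ hΛ').1 (hA Λ Λ' k hΛ hΛ').2.1
    have c1 := abs_mul_inv_energy_le hm k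
    have c2 : k ^ 2 * (energy m k ^ 2)⁻¹ ≤ 1 := by
      have := pow_le_one₀ (n := 2) (by positivity) c1
      rwa [mul_pow, sq_abs, inv_pow] at this
    calc ‖G' k‖ ≤ (A * (2 + m) * (energy m k ^ 2)⁻¹) * (x ^ 2 * k ^ 2 * (1 + (x * k) ^ 2)⁻¹) +
          A * (energy m k)⁻¹ * (2 * x ^ 2 * |k| * (1 + (x * k) ^ 2)⁻¹ ^ 2) := by
          refine (norm_add_le _ _).trans ?_
          rw [norm_mul, norm_mul, e1, e2]
          gcongr
      _ = A * (2 + m) * (x ^ 2 * (1 + (x * k) ^ 2)⁻¹) * (k ^ 2 * (energy m k ^ 2)⁻¹) +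
          2 * A * (x ^ 2 * (1 + (x * k) ^ 2)⁻¹) *
            ((|k| * (energy m k)⁻¹) * (1 + (x * k) ^ 2)⁻¹) := by ring
      _ ≤ A * (2 + m) * (x ^ 2 * (1 + (x * k) ^ 2)⁻¹) * 1 +
          2 * A * (x ^ 2 * (1 + (x * k) ^ 2)⁻¹) * 1 := by
          gcongr
          exact mul_le_one₀ c1 (hq0 k) (hq1 k)
      _ = _ := by
          rw [habs, ← sq_abs x]
          ring
  have hb := (integrable_mul_inv_one_add_sq hx').const_mul ((A * (2 + m) + 2 * A) * |x|)
  have hGi' : Integrable G' :=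
    hb.mono' hGc.aestronglyMeasurable (Eventually.of_forall hbound)
  have h1 := abs_mul_norm_integral_exp_neg_I_mul_le hG hGi hGi' x
  have h2 := integral_mono hGi'.norm hb hbound
  rw [integral_const_mul, integral_mul_inv_one_add_sq hx'] at h2
  refine le_of_mul_le_mul_left ((h1.trans h2).trans (le_of_eq ?_)) hx'
  ring

/-- Uniformly in the cutoffs, the covariance has at most the logarithmic singularity
`(2π)⁻¹ log |x|⁻¹` at coinciding points and is bounded from above away from them. -/
theorem exists_covKernel_le (hm : 0 < m) (hβ : 0 < β) (χ : UVCutoff) :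
    ∃ B : ℝ, ∀ Λ Λ' x : ℝ, 1 ≤ Λ → 1 ≤ Λ' →
      (1 ≤ |x| → covKernel m β χ Λ Λ' x ≤ B) ∧
      (x ≠ 0 → |x| ≤ 1 → covKernel m β χ Λ Λ' x ≤ B - (2 * Real.pi)⁻¹ * Real.log |x|) := by
  obtain ⟨A, hA0, hA⟩ := χ.exists_symbol_bounds
  obtain ⟨B₁, hB₁⟩ := exists_integral_norm_vacuumWeight_mul_le hm χ
  obtain ⟨B₂, hB₂⟩ := exists_norm_integral_vacuumWeight_high_le hm χ
  set T : ℝ := A * (2 * β⁻¹) * ∫ k, (energy m k ^ 2)⁻¹ with hT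
  set D : ℝ := A * (2 + m) * ∫ k, (energy m k ^ 2)⁻¹ with hD
  have hI : 0 ≤ ∫ k, (energy m k ^ 2)⁻¹ := integral_nonneg fun k => by positivity
  have hD0 : 0 ≤ D := by positivity
  have h4 : 0 < (4 * Real.pi)⁻¹ := by positivity
  have hth : ∀ Λ Λ' x : ℝ, 1 ≤ Λ → 1 ≤ Λ' → (∫ k : ℝ, Complex.exp (-(Complex.I * k * x)) *
      (χ.symbol Λ Λ' k * ((2 * thermalDensity m β k * (energy m k)⁻¹ : ℝ) : ℂ))).re ≤ T := by
    intro Λ Λ' x hΛ hΛ'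
    refine (Complex.re_le_norm _).trans ((norm_integral_exp_neg_I_mul_le _ x).trans ?_)
    rw [hT, ← integral_const_mul]
    exact integral_mono (integrable_symbol_mul_thermal_weight hm hβ χ hΛ hΛ').norm
      ((integrable_inv_energy_sq hm).const_mul _)
      fun k => norm_symbol_mul_thermal_weight_le hm hβ (hA Λ Λ' k hΛ hΛ').1
  -- `T` bounds the thermal part everywhere, `D` the vacuum part for `|x| ≥ 1`, and `B₁ + B₂` its
  -- low and high momenta for `|x| ≤ 1`, apart from the logarithm.
  refine ⟨(4 * Real.pi)⁻¹ * (max D (B₁ + B₂) + T), fun Λ Λ' x hΛ hΛ' => ⟨fun hx => ?_, fun hx hx1 => ?_⟩⟩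
  · rw [covKernel_eq_add hm hβ χ hΛ hΛ']
    refine mul_le_mul_of_nonneg_left (add_le_add ?_ (hth Λ Λ' x hΛ hΛ')) h4.le
    refine (Complex.re_le_norm _).trans (le_trans ?_ (le_max_left _ _))
    have h1 := abs_mul_norm_integral_exp_neg_I_mul_le (hasDerivAt_vacuumWeight hm χ Λ Λ')
      (integrable_vacuumWeight hm χ (by linarith) Λ')
      (integrable_vacuumWeightDeriv hm χ hΛ hΛ') x
    have h2 : ∫ k, ‖vacuumWeightDeriv m χ Λ Λ' k‖ ≤ D := by
      rw [hD, ← integral_const_mul]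
      exact integral_mono (integrable_vacuumWeightDeriv hm χ hΛ hΛ').norm
        ((integrable_inv_energy_sq hm).const_mul _)
        fun k => norm_vacuumWeightDeriv_le hm (hA Λ Λ' k hΛ hΛ').1 (hA Λ Λ' k hΛ hΛ').2.1
    refine le_trans ?_ (h1.trans h2)
    exact le_mul_of_one_le_left (norm_nonneg _) hx
  · rw [covKernel_eq_add hm hβ χ hΛ hΛ']
    have hx0 : 0 < |x| := abs_pos.2 hx
    have hq0 : ∀ k : ℝ, 0 ≤ (1 + (|x| * k) ^ 2)⁻¹ := fun k => by positivity
    have hq1 : ∀ k : ℝ, (1 + (|x| * k) ^ 2)⁻¹ ≤ 1 := fun k =>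
      inv_le_one_of_one_le₀ (by nlinarith [sq_nonneg (|x| * k)])
    have habs : ∀ k : ℝ, (x * k) ^ 2 = (|x| * k) ^ 2 := fun k => by
      rw [mul_pow, mul_pow, sq_abs]
    have hc := continuous_inv_one_add_mul_sq |x|
    have hF := integrable_vacuumWeight hm χ (by linarith : Λ ≠ 0) Λ'
    have i1 : Integrable fun k => vacuumWeight m χ Λ Λ' k * (((1 + (|x| * k) ^ 2)⁻¹ : ℝ) : ℂ) := by
      refine hF.mul_bdd (c := 1)
        (Complex.continuous_ofReal.comp hc).aestronglyMeasurable (Eventually.of_forall fun k => ?_)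
      rw [Complex.norm_real, Real.norm_of_nonneg (hq0 k)]
      exact hq1 k
    have i2 : Integrable fun k =>
        vacuumWeight m χ Λ Λ' k * ((1 - (1 + (|x| * k) ^ 2)⁻¹ : ℝ) : ℂ) := by
      refine (hF.sub i1).congr (Eventually.of_forall fun k => ?_)
      simp only [Pi.sub_apply]
      push_cast
      ring
    -- Smooth splitting at momenta of order `1/|x|`: absolute values suffice below this scale,
    -- oscillation is used above it.
    have e : ∫ k : ℝ, Complex.exp (-(Complex.I * k * x)) * vacuumWeight m χ Λ Λ' k
        = (∫ k : ℝ, Complex.exp (-(Complex.I * k * x)) *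
            (vacuumWeight m χ Λ Λ' k * (((1 + (|x| * k) ^ 2)⁻¹ : ℝ) : ℂ))) +
          ∫ k : ℝ, Complex.exp (-(Complex.I * k * x)) *
            (vacuumWeight m χ Λ Λ' k * ((1 - (1 + (|x| * k) ^ 2)⁻¹ : ℝ) : ℂ)) := by
      rw [← integral_add (integrable_exp_neg_I_mul i1 x) (integrable_exp_neg_I_mul i2 x)]
      congr 1
      funext k
      push_cast
      ring
    have b1 := (norm_integral_exp_neg_I_mul_le _ x).trans (hB₁ Λ Λ' |x| hΛ hΛ' hx0 hx1)
    have b2 := hB₂ Λ Λ' x hΛ hΛ' hx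
    simp_rw [habs] at b2
    have hmain : (∫ k : ℝ, Complex.exp (-(Complex.I * k * x)) * vacuumWeight m χ Λ Λ' k).re
        ≤ max D (B₁ + B₂) - 2 * Real.log |x| := by
      refine (Complex.re_le_norm _).trans ?_
      rw [e]
      refine (norm_add_le _ _).trans ?_
      linarith [le_max_right D (B₁ + B₂)]
    refine (mul_le_mul_of_nonneg_left (add_le_add hmain (hth Λ Λ' x hΛ hΛ')) h4.le).trans
      (le_of_eq ?_)
    field_simp
    ring

end LogBound

/-! ### Inner products of Wick-ordered exponentials -/

section Wick

variable {m β : ℝ}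

theorem integrable_weight_mul_norm_sq (hm : 0 < m) (hβ : 0 < β) (f : OneParticle) :
    Integrable fun k => (1 + 2 * thermalDensity m β k) * ‖f k‖ ^ 2 := by
  have hc := continuous_thermalDensity hm hβ
  refine (Lp.memLp f).integrable_norm_pow (by norm_num) |>.bdd_mul (c := 1 + 2 * (β⁻¹ * m⁻¹))
    (by fun_prop : Continuous fun k => 1 + 2 * thermalDensity m β k).aestronglyMeasurable
    (Eventually.of_forall fun k => ?_)
  have h0 := thermalDensity_nonneg hm hβ k
  rw [Real.norm_of_nonneg (by linarith)]
  have h1 := thermalDensity_le hm hβ k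
  have h2 : β⁻¹ * (energy m k)⁻¹ ≤ β⁻¹ * m⁻¹ := by
    gcongr
    exact le_energy m k
  linarith

/-- Polarization; the cross term carries no `1/2` because it is twice the bilinear form. -/
theorem covBeta_add (hm : 0 < m) (hβ : 0 < β) (f f' : realSubspace) :
    covBeta m β (f + f') = covBeta m β f + covBeta m β f' +
      ∫ k : ℝ, (1 + 2 * thermalDensity m β k) *
        ((f : OneParticle) k * star ((f' : OneParticle) k)).re := by
  have i1 := integrable_weight_mul_norm_sq hm hβ (f : OneParticle)
  have i2 := integrable_weight_mul_norm_sq hm hβ (f' : OneParticle)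
  have i3 := integrable_weight_mul_norm_sq hm hβ ((f + f' : realSubspace) : OneParticle)
  have e : ∫ k : ℝ, (1 + 2 * thermalDensity m β k) *
        ((f : OneParticle) k * star ((f' : OneParticle) k)).re
      = ∫ k : ℝ, (1 / 2) * ((1 + 2 * thermalDensity m β k) *
          ‖((f + f' : realSubspace) : OneParticle) k‖ ^ 2 -
        (1 + 2 * thermalDensity m β k) * ‖(f : OneParticle) k‖ ^ 2 -
        (1 + 2 * thermalDensity m β k) * ‖(f' : OneParticle) k‖ ^ 2) := by
    refine integral_congr_ae ?_
    filter_upwards [Lp.coeFn_add (f : OneParticle) (f' : OneParticle)] with k hk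
    have h : ((f + f' : realSubspace) : OneParticle) k
        = (f : OneParticle) k + (f' : OneParticle) k := hk
    rw [h, ← Complex.normSq_eq_norm_sq, ← Complex.normSq_eq_norm_sq, ← Complex.normSq_eq_norm_sq,
      Complex.normSq_add, Complex.star_def]
    ring
  rw [e, integral_const_mul]
  have h1 := integral_sub (i3.sub i1) i2
  have h2 := integral_sub i3 i1
  simp only [Pi.sub_apply] at h1 h2
  rw [h1, h2]
  unfold covBeta
  ring

theorem coeFn_sqrt_two_smul_cutoffVec (hm : 0 < m) (χ : UVCutoff) (Λ : Set.Ici (1 : ℝ)) (x : ℝ) :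
    (((Real.sqrt 2 • cutoffVec hm χ Λ x : realSubspace) : OneParticle) : ℝ → ℂ)
      =ᵐ[volume] fun k => (Real.sqrt 2 : ℂ) * cutoffFun m χ Λ x k := by
  have h1 : (((Real.sqrt 2 • cutoffVec hm χ Λ x : realSubspace) : OneParticle) : ℝ → ℂ)
      =ᵐ[volume] Real.sqrt 2 • ((cutoffVec hm χ Λ x : OneParticle) : ℝ → ℂ) :=
    Lp.coeFn_smul (Real.sqrt 2) (cutoffVec hm χ Λ x : OneParticle)
  have h2 : ((cutoffVec hm χ Λ x : OneParticle) : ℝ → ℂ) =ᵐ[volume] cutoffFun m χ Λ x :=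
    (memLp_cutoffFun hm χ (zero_lt_one.trans_le Λ.2) x).coeFn_toLp
  filter_upwards [h1, h2] with k e1 e2
  rw [e1, Pi.smul_apply, e2, Complex.real_smul]

/-- The source of translation invariance: the positions enter only through the phase, hence only
through `x - y`. -/
theorem cutoffFun_mul_star (hm : 0 < m) (χ : UVCutoff) (Λ Λ' x y k : ℝ) :
    (Real.sqrt 2 : ℂ) * cutoffFun m χ Λ x k * star ((Real.sqrt 2 : ℂ) * cutoffFun m χ Λ' y k)
      = ((2 * (4 * Real.pi)⁻¹ * (energy m k)⁻¹ : ℝ) : ℂ) *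
        (Complex.exp (-(Complex.I * k * ((x - y : ℝ) : ℂ))) * χ.symbol Λ Λ' k) := by
  have hp := energy_pos hm k
  have e1 : Real.sqrt 2 * Real.sqrt 2 = 2 := Real.mul_self_sqrt (by norm_num)
  have e2 : (1 / Real.sqrt (4 * Real.pi)) * (1 / Real.sqrt (4 * Real.pi)) = (4 * Real.pi)⁻¹ := by
    rw [div_mul_div_comm, Real.mul_self_sqrt (by positivity), one_mul, one_div]
  have e3 : energy m k ^ (-(1 / 2) : ℝ) * energy m k ^ (-(1 / 2) : ℝ) = (energy m k)⁻¹ := by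
    rw [← Real.rpow_add hp, ← Real.rpow_neg_one]
    norm_num
  have e4 : Complex.exp (-(Complex.I * k * ((x - y : ℝ) : ℂ)))
      = Complex.exp (-(Complex.I * k * x)) * star (Complex.exp (-(Complex.I * k * y))) := by
    rw [Complex.star_def, ← Complex.exp_conj, ← Complex.exp_add]
    simp
    ring_nf
  have e5 : 2 * (4 * Real.pi)⁻¹ * (energy m k)⁻¹ = (Real.sqrt 2 * Real.sqrt 2) *
      ((1 / Real.sqrt (4 * Real.pi)) * (1 / Real.sqrt (4 * Real.pi))) *
      (energy m k ^ (-(1 / 2) : ℝ) * energy m k ^ (-(1 / 2) : ℝ)) := by rw [e1, e2, e3]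
  rw [e4, e5]
  unfold cutoffFun UVCutoff.symbol
  simp only [star_mul', Complex.star_def, Complex.conj_ofReal]
  push_cast
  ring

theorem covBeta_add_cutoffVec (hm : 0 < m) (hβ : 0 < β) (χ : UVCutoff) (Λ Λ' : Set.Ici (1 : ℝ))
    (x y : ℝ) :
    covBeta m β (Real.sqrt 2 • cutoffVec hm χ Λ x + Real.sqrt 2 • cutoffVec hm χ Λ' y)
      = covBeta m β (Real.sqrt 2 • cutoffVec hm χ Λ x) +
        covBeta m β (Real.sqrt 2 • cutoffVec hm χ Λ' y) + 2 * covKernel m β χ Λ Λ' (x - y) := by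
  rw [covBeta_add hm hβ]
  congr 1
  have hi : Integrable fun k : ℝ => Complex.exp (-(Complex.I * k * ((x - y : ℝ) : ℂ))) *
      (χ.symbol Λ Λ' k * (((1 + 2 * thermalDensity m β k) * (energy m k)⁻¹ : ℝ) : ℂ)) := by
    refine integrable_exp_neg_I_mul ?_ (x - y)
    refine ((integrable_vacuumWeight hm χ (zero_lt_one.trans_le Λ.2).ne' Λ').add
      (integrable_symbol_mul_thermal_weight hm hβ χ Λ.2 Λ'.2)).congr
      (Eventually.of_forall fun k => ?_)
    simp only [Pi.add_apply, vacuumWeight]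
    push_cast
    ring
  have hre := integral_re hi
  simp only [RCLike.re_eq_complex_re] at hre
  rw [covKernel, ← mul_assoc, ← hre, ← integral_const_mul]
  refine integral_congr_ae ?_
  filter_upwards [coeFn_sqrt_two_smul_cutoffVec hm χ Λ x,
    coeFn_sqrt_two_smul_cutoffVec hm χ Λ' y] with k h1 h2
  rw [h1, h2, cutoffFun_mul_star hm, Complex.re_ofReal_mul, ← mul_assoc (Complex.exp _),
    Complex.re_mul_ofReal]
  ring

/-- Wick ordering with respect to `c` differs from thermal Wick ordering of the cutoff field by
factors that do not depend on the position and converge when the cutoff is removed. -/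
theorem exists_cov_cutoffVec_eq (hm : 0 < m) (hβ : 0 < β) (χ : UVCutoff)
    {c : realSubspace → ℝ} (hc : c = covZero ∨ c = covBeta m β) :
    ∃ (d : Set.Ici (1 : ℝ) → ℝ) (d' : ℝ), Tendsto d atTop (𝓝 d') ∧
      ∀ Λ x, c (Real.sqrt 2 • cutoffVec hm χ Λ x)
        = covBeta m β (Real.sqrt 2 • cutoffVec hm χ Λ x) - d Λ := by
  rcases hc with rfl | rfl
  swap
  · exact ⟨fun _ => 0, 0, tendsto_const_nhds, fun Λ x => (sub_zero _).symm⟩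
  -- The difference `c_β - c₀` retains only the `2ρ` part of the weight; the norm of the symbol at
  -- equal cutoffs is `|χ̂(k/Λ)|²`, and the phase has modulus one, so `x` drops out.
  refine ⟨fun Λ => (4 * Real.pi)⁻¹ * ∫ k : ℝ,
      2 * thermalDensity m β k * (energy m k)⁻¹ * ‖χ.symbol Λ Λ k‖,
    (4 * Real.pi)⁻¹ * ∫ k : ℝ, 2 * thermalDensity m β k * (energy m k)⁻¹, ?_, fun Λ x => ?_⟩
  · obtain ⟨A, hA0, hA⟩ := χ.exists_symbol_bounds
    have hΛ : Tendsto (fun Λ : Set.Ici (1 : ℝ) => (Λ : ℝ)) atTop atTop :=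
      tendsto_Ici_atTop.1 tendsto_id
    have h1 := continuous_thermalDensity hm hβ
    have h2 := continuous_inv_energy hm
    refine Tendsto.const_mul _ (tendsto_integral_filter_of_dominated_convergence
      (fun k => A * (2 * β⁻¹) * (energy m k ^ 2)⁻¹)
      (Eventually.of_forall fun Λ => ?_)
      (Eventually.of_forall fun Λ => Eventually.of_forall fun k => ?_)
      ((integrable_inv_energy_sq hm).const_mul _) (Eventually.of_forall fun k => ?_))
    · have := χ.continuous_symbol Λ Λ
      exact (by fun_prop : Continuous _).aestronglyMeasurable
    · have := norm_symbol_mul_thermal_weight_le hm hβ (hA Λ Λ k Λ.2 Λ.2).1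
      rw [norm_mul, Complex.norm_real] at this
      rw [norm_mul, norm_norm, mul_comm]
      exact this
    · have := (χ.tendsto_symbol k hΛ hΛ).norm.const_mul
        (2 * thermalDensity m β k * (energy m k)⁻¹)
      rwa [norm_one, mul_one] at this
  · set f : realSubspace := Real.sqrt 2 • cutoffVec hm χ Λ x with hf
    have hn : ‖(f : OneParticle)‖ ^ 2 = ∫ k : ℝ, ‖(f : OneParticle) k‖ ^ 2 := by
      rw [← real_inner_self_eq_norm_sq, L2.inner_def]
      simp_rw [real_inner_self_eq_norm_sq]
    have i1 := integrable_weight_mul_norm_sq hm hβ (f : OneParticle)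
    have i2 := (Lp.memLp (f : OneParticle)).integrable_norm_pow (p := 2) (by norm_num)
    have e : (4 * Real.pi)⁻¹ * ∫ k : ℝ,
        2 * thermalDensity m β k * (energy m k)⁻¹ * ‖χ.symbol Λ Λ k‖
        = (1 / 2) * ∫ k : ℝ, ((1 + 2 * thermalDensity m β k) * ‖(f : OneParticle) k‖ ^ 2 -
          ‖(f : OneParticle) k‖ ^ 2) := by
      rw [← integral_const_mul, ← integral_const_mul]
      refine integral_congr_ae ?_
      filter_upwards [coeFn_sqrt_two_smul_cutoffVec hm χ Λ x] with k hk
      have h1 : ‖(f : OneParticle) k‖ ^ 2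
          = 2 * (4 * Real.pi)⁻¹ * (energy m k)⁻¹ * ‖χ.symbol Λ Λ k‖ := by
        have h := congrArg norm (cutoffFun_mul_star hm χ Λ Λ x x k)
        rw [norm_mul, norm_star, norm_mul (Complex.ofReal _) (_ * _), norm_mul (Complex.exp _),
          norm_exp_neg_I_mul, Complex.norm_real, Real.norm_of_nonneg, one_mul, ← hk] at h
        · rw [sq]
          exact h
        · have := energy_pos hm k
          positivity
      rw [h1]
      ring
    beta_reduce
    rw [e, integral_sub i1 i2, covZero, hn, covBeta]
    ring

/-! ### Two-point functions from the Gaussian law -/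

variable {Q : Type*} [MeasurableSpace Q] {μ : Measure Q} [IsProbabilityMeasure μ]

theorem ThermalField.integral_exp_field (hm : 0 < m) (hβ : 0 < β) (φ : ThermalField m β μ)
    (α : ℝ) (f : realSubspace) :
    ∫ q, Real.exp (α * φ.field f q) ∂μ = Real.exp (α ^ 2 / 2 * covBeta m β f) := by
  have h := mgf_gaussianReal (φ.map_field hm hβ f) α
  rw [mgf, Real.coe_toNNReal _ (covBeta_nonneg hm hβ f)] at h
  rw [h]
  ring_nf

/-- By linearity of the field the product of the two exponentials is the exponential of `φ_ω(f +
f')`, whose mean is a Gaussian moment generating function. -/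
theorem ThermalField.inner_wickExp (hm : 0 < m) (hβ : 0 < β) (φ : ThermalField m β μ)
    (c : realSubspace → ℝ) (α : ℝ) (f f' : realSubspace) :
    inner ℝ (wickExp hm hβ φ c α f) (wickExp hm hβ φ c α f')
      = Real.exp (α ^ 2 / 2 * (covBeta m β (f + f') - c f - c f')) := by
  have h1 := (memLp_wickExpFun hm hβ φ c α f).coeFn_toLp
  have h2 := (memLp_wickExpFun hm hβ φ c α f').coeFn_toLp
  have h3 : (φ.field (f + f') : Q → ℝ) =ᵐ[μ] φ.field f + φ.field f' := by
    rw [map_add]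
    exact AEEqFun.coeFn_add _ _
  have e : Real.exp (α ^ 2 / 2 * (covBeta m β (f + f') - c f - c f'))
      = (∫ q, Real.exp (α * φ.field (f + f') q) ∂μ) * Real.exp (-(α ^ 2 / 2) * (c f + c f')) := by
    rw [φ.integral_exp_field hm hβ, ← Real.exp_add]
    ring_nf
  rw [e, L2.inner_def, ← integral_mul_const]
  refine integral_congr_ae ?_
  filter_upwards [h1, h2, h3] with q e1 e2 e3
  change inner ℝ ((memLp_wickExpFun hm hβ φ c α f).toLp _ q)
    ((memLp_wickExpFun hm hβ φ c α f').toLp _ q) = _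
  rw [e1, e2, e3, Pi.add_apply, real_inner_eq_re_inner ℝ]
  simp only [wickExpFun, RCLike.inner_apply, conj_trivial, RCLike.re_to_real, ← Real.exp_add]
  ring_nf

/-- The two-point function of the Wick-ordered exponential of the cutoff field. -/
theorem ThermalField.inner_wickExpCutoff (hm : 0 < m) (hβ : 0 < β) (φ : ThermalField m β μ)
    (χ : UVCutoff) (α : ℝ) {c : realSubspace → ℝ} {d : Set.Ici (1 : ℝ) → ℝ}
    (hd : ∀ Λ x, c (Real.sqrt 2 • cutoffVec hm χ Λ x)
        = covBeta m β (Real.sqrt 2 • cutoffVec hm χ Λ x) - d Λ)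
    (Λ Λ' : Set.Ici (1 : ℝ)) (x y : ℝ) :
    inner ℝ (wickExpCutoff hm hβ φ c χ α Λ x) (wickExpCutoff hm hβ φ c χ α Λ' y)
      = Real.exp (α ^ 2 / 2 * (d Λ + d Λ')) *
        Real.exp (α ^ 2 * covKernel m β χ Λ Λ' (x - y)) := by
  unfold wickExpCutoff
  rw [φ.inner_wickExp, covBeta_add_cutoffVec hm hβ, hd, hd, ← Real.exp_add]
  ring_nf

/-- The squared distance of two values is a combination of two-point functions, so continuity of
`covKernel` is enough. This supplies strong measurability for the Bochner integral. -/
theorem continuous_wickExpCutoff (hm : 0 < m) (hβ : 0 < β) (φ : ThermalField m β μ)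
    (χ : UVCutoff) (α : ℝ) {c : realSubspace → ℝ} {d : Set.Ici (1 : ℝ) → ℝ}
    (hd : ∀ Λ x, c (Real.sqrt 2 • cutoffVec hm χ Λ x)
        = covBeta m β (Real.sqrt 2 • cutoffVec hm χ Λ x) - d Λ)
    (Λ : Set.Ici (1 : ℝ)) : Continuous (wickExpCutoff hm hβ φ c χ α Λ) := by
  rw [continuous_iff_continuousAt]
  intro x
  rw [ContinuousAt, tendsto_iff_norm_sub_tendsto_zero]
  have hk := continuous_covKernel hm hβ χ Λ.2 Λ.2
  have h2 : Tendsto (fun y => ‖wickExpCutoff hm hβ φ c χ α Λ y - wickExpCutoff hm hβ φ c χ α Λ x‖ ^ 2)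
      (𝓝 x) (𝓝 0) := by
    simp_rw [norm_sub_sq_real, ← real_inner_self_eq_norm_sq, φ.inner_wickExpCutoff hm hβ χ α hd]
    refine Continuous.tendsto' (by fun_prop) _ _ ?_
    rw [sub_self]
    ring
  have := h2.sqrt
  simpa [Real.sqrt_sq (norm_nonneg _)] using this

/-- By translation invariance the norm of the Wick exponential does not depend on `x`, so `g ∈ L¹`
suffices at fixed cutoff, for every `α`. -/
theorem integrable_smul_wickExpCutoff (hm : 0 < m) (hβ : 0 < β) (φ : ThermalField m β μ)
    (χ : UVCutoff) (α : ℝ) {c : realSubspace → ℝ} {d : Set.Ici (1 : ℝ) → ℝ}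
    (hd : ∀ Λ x, c (Real.sqrt 2 • cutoffVec hm χ Λ x)
        = covBeta m β (Real.sqrt 2 • cutoffVec hm χ Λ x) - d Λ)
    {g : ℝ → ℝ} (hg : Integrable g) (Λ : Set.Ici (1 : ℝ)) :
    Integrable (fun x : ℝ => g x • wickExpCutoff hm hβ φ c χ α Λ x) := by
  have hn : ∀ x, ‖wickExpCutoff hm hβ φ c χ α Λ x‖ = ‖wickExpCutoff hm hβ φ c χ α Λ 0‖ := by
    intro x
    refine (sq_eq_sq₀ (norm_nonneg _) (norm_nonneg _)).1 ?_
    rw [← real_inner_self_eq_norm_sq, ← real_inner_self_eq_norm_sq,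
      φ.inner_wickExpCutoff hm hβ χ α hd, φ.inner_wickExpCutoff hm hβ χ α hd, sub_self, sub_self]
  exact hg.smul_bdd ‖wickExpCutoff hm hβ φ c χ α Λ 0‖
    (continuous_wickExpCutoff hm hβ φ χ α hd Λ).aestronglyMeasurable
    (Eventually.of_forall fun x => (hn x).le)

theorem inner_interaction (hm : 0 < m) (hβ : 0 < β) (φ : ThermalField m β μ)
    (χ : UVCutoff) (α : ℝ) {c : realSubspace → ℝ} {d : Set.Ici (1 : ℝ) → ℝ}
    (hd : ∀ Λ x, c (Real.sqrt 2 • cutoffVec hm χ Λ x)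
        = covBeta m β (Real.sqrt 2 • cutoffVec hm χ Λ x) - d Λ)
    {g : ℝ → ℝ} (hg : Integrable g) (Λ Λ' : Set.Ici (1 : ℝ)) :
    inner ℝ (interaction hm hβ φ c χ g α Λ) (interaction hm hβ φ c χ g α Λ')
      = Real.exp (α ^ 2 / 2 * (d Λ + d Λ')) *
        ∫ x, ∫ y, g x * g y * Real.exp (α ^ 2 * covKernel m β χ Λ Λ' (x - y)) := by
  have h := integrable_smul_wickExpCutoff hm hβ φ χ α hd hg
  unfold interaction
  rw [real_inner_comm, ← integral_inner (h Λ), ← integral_const_mul]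
  congr 1
  funext x
  rw [real_inner_comm, ← integral_inner (h Λ'), ← integral_const_mul]
  congr 1
  funext y
  rw [real_inner_smul_left, real_inner_smul_right, φ.inner_wickExpCutoff hm hβ χ α hd]
  ring

end Wick

/-! ### Removal of the cutoff -/

section Limit

/-- If `k` is integrable and `g` is integrable and square-integrable, then
`g(x) g(y) (1 + k(x - y))` is integrable on the plane. -/
theorem integrable_mul_mul_one_add_sub {g k : ℝ → ℝ} (hg1 : Integrable g) (hg2 : MemLp g 2 volume)
    (hk : Integrable k) :
    Integrable (fun p : ℝ × ℝ => g p.1 * g p.2 * (1 + k (p.1 - p.2)))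
      (volume.prod volume) := by
  have hsq := hg2.integrable_sq
  have h1 : Integrable (fun p : ℝ × ℝ => g p.2 ^ 2 * k (p.1 - p.2)) (volume.prod volume) :=
    hsq.convolution_integrand (ContinuousLinearMap.mul ℝ ℝ) hk
  -- The mirror image of `h1`, by exchanging the variables and reflecting `k`. Together they
  -- dominate the mixed term, since `|g(x) g(y)| ≤ g(x)² + g(y)²`.
  have h2 : Integrable (fun p : ℝ × ℝ => g p.1 ^ 2 * k (p.1 - p.2)) (volume.prod volume) := by
    have := (hsq.convolution_integrand (ContinuousLinearMap.mul ℝ ℝ) hk.comp_neg).swap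
    simpa [Function.comp_def] using this
  have hm : AEStronglyMeasurable (fun p : ℝ × ℝ => k (p.1 - p.2)) (volume.prod volume) :=
    hk.1.comp_quasiMeasurePreserving (quasiMeasurePreserving_sub_of_right_invariant volume volume)
  have hgg := hg1.mul_prod hg1
  have h3 : Integrable (fun p : ℝ × ℝ => g p.1 * g p.2 * k (p.1 - p.2)) (volume.prod volume) := by
    refine (h1.norm.add h2.norm).mono' (hgg.1.mul hm) (Eventually.of_forall fun p => ?_)
    simp only [Pi.add_apply, norm_mul, norm_pow]
    nlinarith [mul_nonneg (sq_nonneg (‖g p.1‖ - ‖g p.2‖)) (norm_nonneg (k (p.1 - p.2))),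
      mul_nonneg (add_nonneg (sq_nonneg ‖g p.1‖) (sq_nonneg ‖g p.2‖))
        (norm_nonneg (k (p.1 - p.2)))]
  refine (hgg.add h3).congr (Eventually.of_forall fun p => ?_)
  simp only [Pi.add_apply]
  ring

variable {m β : ℝ}

/-- Below the critical coupling the exponential of the covariance has an integrable singularity,
uniformly in the cutoffs. -/
theorem exists_exp_covKernel_le (hm : 0 < m) (hβ : 0 < β) (χ : UVCutoff) {α : ℝ}
    (hα : |α| < Real.sqrt (2 * Real.pi)) :
    ∃ (M : ℝ) (k : ℝ → ℝ), Integrable k ∧ ∀ Λ Λ' x : ℝ, 1 ≤ Λ → 1 ≤ Λ' → x ≠ 0 →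
      Real.exp (α ^ 2 * covKernel m β χ Λ Λ' x) ≤ M * (1 + k x) := by
  obtain ⟨B, hB⟩ := exists_covKernel_le hm hβ χ
  -- The exponent of the singularity `|x|^{-δ}`; the hypothesis on `α` is exactly `δ < 1`.
  set δ : ℝ := α ^ 2 * (2 * Real.pi)⁻¹ with hδ
  have hδ1 : δ < 1 := by
    have h := (Real.lt_sqrt (abs_nonneg α)).1 hα
    rw [sq_abs] at h
    rwa [hδ, ← div_eq_mul_inv, div_lt_one (by positivity)]
  let v : ℝ → ℝ := (Set.Ioc 0 1).indicator fun x => x ^ (-δ)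
  have hv : Integrable v := by
    refine (integrable_indicator_iff measurableSet_Ioc).2 ?_
    exact (intervalIntegrable_iff_integrableOn_Ioc_of_le zero_le_one).1
      (intervalIntegral.intervalIntegrable_rpow' (by linarith))
  have hv0 : ∀ x, 0 ≤ v x := fun x =>
    Set.indicator_nonneg (fun x hx => Real.rpow_nonneg hx.1.le _) x
  refine ⟨Real.exp (α ^ 2 * B), fun x => v x + v (-x), hv.add hv.comp_neg,
    fun Λ Λ' x hΛ hΛ' hx => ?_⟩
  obtain ⟨h1, h2⟩ := hB Λ Λ' x hΛ hΛ'
  rcases le_total 1 |x| with h | h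
  · calc _ ≤ Real.exp (α ^ 2 * B) * 1 := by
          rw [mul_one]
          gcongr
          exact h1 h
      _ ≤ _ := by
          gcongr
          linarith [hv0 x, hv0 (-x)]
  · have hx0 : 0 < |x| := abs_pos.2 hx
    have hvx : |x| ^ (-δ) ≤ v x + v (-x) := by
      have hm : ∀ y, 0 < y → y ≤ 1 → v y = y ^ (-δ) := fun y h0 h1 =>
        Set.indicator_of_mem (Set.mem_Ioc.2 ⟨h0, h1⟩) _
      rcases abs_cases x with ⟨e, -⟩ | ⟨e, -⟩
      · rw [e] at hx0 h ⊢
        linarith [hm x hx0 h, hv0 (-x)]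
      · rw [e] at hx0 h ⊢
        linarith [hm (-x) hx0 h, hv0 x]
    calc _ ≤ Real.exp (α ^ 2 * (B - (2 * Real.pi)⁻¹ * Real.log |x|)) := by
          gcongr
          exact h2 hx h
      _ = Real.exp (α ^ 2 * B) * |x| ^ (-δ) := by
          rw [Real.rpow_def_of_pos hx0, ← Real.exp_add, hδ]
          ring_nf
      _ ≤ _ := by
          gcongr
          linarith

/-- Dominated convergence on the plane, off the null diagonal where the covariance bounds fail. The
product filter lets both cutoffs go to infinity independently, as the Cauchy criterion requires. -/
theorem exists_tendsto_integral_exp_covKernel (hm : 0 < m) (hβ : 0 < β) (χ : UVCutoff) {α : ℝ}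
    (hα : |α| < Real.sqrt (2 * Real.pi)) {g : ℝ → ℝ} (hg1 : Integrable g)
    (hg2 : MemLp g 2 volume) :
    ∃ L : ℝ, Tendsto (fun p : Set.Ici (1 : ℝ) × Set.Ici (1 : ℝ) =>
      ∫ x, ∫ y, g x * g y * Real.exp (α ^ 2 * covKernel m β χ p.1 p.2 (x - y)))
      (atTop ×ˢ atTop) (𝓝 L) := by
  obtain ⟨C, hC⟩ := exists_tendsto_covKernel hm hβ χ
  obtain ⟨M, k, hk, hM⟩ := exists_exp_covKernel_le hm hβ χ hα
  have hne : ∀ᵐ z : ℝ × ℝ ∂(volume.prod volume), z.1 - z.2 ≠ 0 :=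
    (quasiMeasurePreserving_sub_of_right_invariant volume volume).ae (p := fun x : ℝ => x ≠ 0)
      (Measure.ae_ne volume 0)
  have hbi : Integrable (fun z : ℝ × ℝ => M * (‖g z.1‖ * ‖g z.2‖ * (1 + k (z.1 - z.2))))
      (volume.prod volume) :=
    (integrable_mul_mul_one_add_sub hg1.norm hg2.norm hk).const_mul M
  have hmeas : ∀ p : Set.Ici (1 : ℝ) × Set.Ici (1 : ℝ), AEStronglyMeasurable (fun z : ℝ × ℝ =>
      g z.1 * g z.2 * Real.exp (α ^ 2 * covKernel m β χ p.1 p.2 (z.1 - z.2)))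
      (volume.prod volume) := fun p => by
    have hc := continuous_covKernel hm hβ χ p.1.2 p.2.2
    exact (hg1.mul_prod hg1).1.mul (by fun_prop : Continuous _).aestronglyMeasurable
  have hbound : ∀ p : Set.Ici (1 : ℝ) × Set.Ici (1 : ℝ), ∀ᵐ z : ℝ × ℝ ∂(volume.prod volume),
      ‖g z.1 * g z.2 * Real.exp (α ^ 2 * covKernel m β χ p.1 p.2 (z.1 - z.2))‖
        ≤ M * (‖g z.1‖ * ‖g z.2‖ * (1 + k (z.1 - z.2))) := fun p => by
    filter_upwards [hne] with z hz
    rw [norm_mul, norm_mul, Real.norm_of_nonneg (Real.exp_pos _).le]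
    calc _ ≤ ‖g z.1‖ * ‖g z.2‖ * (M * (1 + k (z.1 - z.2))) := by
          gcongr
          exact hM _ _ _ p.1.2 p.2.2 hz
      _ = _ := by ring
  have hint := fun p => integral_prod _ (hbi.mono' (hmeas p) (hbound p))
  refine ⟨∫ z : ℝ × ℝ, g z.1 * g z.2 * Real.exp (α ^ 2 * C (z.1 - z.2)) ∂(volume.prod volume), ?_⟩
  simp_rw [← hint]
  have hΛ : Tendsto (fun Λ : Set.Ici (1 : ℝ) => (Λ : ℝ)) atTop atTop :=
    tendsto_Ici_atTop.1 tendsto_id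
  refine tendsto_integral_filter_of_dominated_convergence _ (Eventually.of_forall hmeas)
    (Eventually.of_forall hbound) hbi ?_
  filter_upwards [hne] with z hz
  have := hC _ hz (l := (atTop ×ˢ atTop : Filter (Set.Ici (1 : ℝ) × Set.Ici (1 : ℝ))))
    (Λ := fun p => p.1) (Λ' := fun p => p.2) (fun p => p.1.2) (fun p => p.2.2)
    (hΛ.comp tendsto_fst) (hΛ.comp tendsto_snd)
  exact ((Real.continuous_exp.tendsto _).comp (this.const_mul _)).const_mul _

/-- A family whose Gram matrix converges is Cauchy. -/
theorem cauchy_map_of_tendsto_inner {H ι : Type*} [NormedAddCommGroup H] [InnerProductSpace ℝ H]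
    {l : Filter ι} [l.NeBot] {u : ι → H} {L : ℝ}
    (h : Tendsto (fun p : ι × ι => inner ℝ (u p.1) (u p.2)) (l ×ˢ l) (𝓝 L)) :
    Cauchy (map u l) := by
  have hd : Tendsto (fun i => inner ℝ (u i) (u i)) l (𝓝 L) :=
    h.comp (tendsto_id.prodMk tendsto_id)
  have h2 : Tendsto (fun p : ι × ι => ‖u p.1 - u p.2‖ ^ 2) (l ×ˢ l) (𝓝 0) := by
    simp_rw [norm_sub_sq_real, ← real_inner_self_eq_norm_sq]
    have := ((hd.comp tendsto_fst).sub (h.const_mul 2)).add (hd.comp tendsto_snd)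
    rwa [show L - 2 * L + L = 0 by ring] at this
  refine cauchy_map_iff.2 ⟨‹_›, tendsto_uniformity_iff_dist_tendsto_zero.2 ?_⟩
  simpa [dist_eq_norm, Real.sqrt_sq (norm_nonneg _)] using h2.sqrt

/-- Compatibility of order and scalars, needed for the positivity of `L²`-valued integrals. -/
theorem isOrderedModule_Lp {Q : Type*} [MeasurableSpace Q] (μ : Measure Q) :
    IsOrderedModule ℝ (Lp ℝ 2 μ) := by
  refine IsOrderedModule.of_smul_nonneg fun a ha f hf => ?_
  rw [← Lp.coeFn_nonneg] at hf ⊢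
  filter_upwards [hf, Lp.coeFn_smul a f] with q h1 h2
  rw [h2]
  exact mul_nonneg ha h1

variable {Q : Type*} [MeasurableSpace Q] {μ : Measure Q} [IsProbabilityMeasure μ]

theorem wickExp_nonneg (hm : 0 < m) (hβ : 0 < β) (φ : ThermalField m β μ)
    (c : realSubspace → ℝ) (α : ℝ) (f : realSubspace) : 0 ≤ wickExp hm hβ φ c α f := by
  rw [← Lp.coeFn_nonneg]
  filter_upwards [(memLp_wickExpFun hm hβ φ c α f).coeFn_toLp] with q hq
  change (0 : ℝ) ≤ (memLp_wickExpFun hm hβ φ c α f).toLp _ q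
  rw [hq]
  exact mul_nonneg (Real.exp_pos _).le (Real.exp_pos _).le

theorem interaction_nonneg (hm : 0 < m) (hβ : 0 < β) (φ : ThermalField m β μ)
    (c : realSubspace → ℝ) (χ : UVCutoff) {g : ℝ → ℝ} (hg : 0 ≤ᵐ[volume] g) (α : ℝ)
    (Λ : Set.Ici (1 : ℝ)) : 0 ≤ interaction hm hβ φ c χ g α Λ := by
  have := isOrderedModule_Lp μ
  refine integral_nonneg_of_ae ?_
  filter_upwards [hg] with x hx
  exact smul_nonneg hx (wickExp_nonneg hm hβ φ c α _)

end Limit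

end HoeghKrohn

/-! ### Convergence of the cutoff interactions -/

theorem proposition9p6 {Q : Type*} [MeasurableSpace Q] (μ : Measure Q) [IsProbabilityMeasure μ]
    {m β : ℝ} (hm : 0 < m) (hβ : 0 < β) (φ : HoeghKrohn.ThermalField m β μ)
    (χ : HoeghKrohn.UVCutoff) (g : ℝ → ℝ) (hg : 0 ≤ᵐ[volume] g)
    (hg1 : MemLp g 1 volume) (hg2 : MemLp g 2 volume)
    (α : ℝ) (hα : |α| < Real.sqrt (2 * Real.pi))
    -- Wick ordering at temperature zero, or at inverse temperature `β`
    (c : HoeghKrohn.realSubspace → ℝ)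
    (hc : c = HoeghKrohn.covZero ∨ c = HoeghKrohn.covBeta m β) :
    (∀ Λ : Set.Ici (1 : ℝ),
      Integrable (fun x : ℝ => g x • HoeghKrohn.wickExpCutoff hm hβ φ c χ α Λ x) volume) ∧
    Cauchy (Filter.map (HoeghKrohn.interaction hm hβ φ c χ g α) atTop) ∧
    ∃ V : Lp ℝ 2 μ, 0 ≤ V ∧
      Tendsto (HoeghKrohn.interaction hm hβ φ c χ g α) atTop (𝓝 V) := by
  -- From here on both Wick orderings are treated at once, through the convergent correction `d`.
  obtain ⟨d, d', hd', hd⟩ := HoeghKrohn.exists_cov_cutoffVec_eq hm hβ χ hc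
  have hgi : Integrable g := memLp_one_iff_integrable.1 hg1
  obtain ⟨L, hL⟩ := HoeghKrohn.exists_tendsto_integral_exp_covKernel hm hβ χ hα hgi hg2
  have hcauchy : Cauchy (Filter.map (HoeghKrohn.interaction hm hβ φ c χ g α) atTop) := by
    refine HoeghKrohn.cauchy_map_of_tendsto_inner
      (L := Real.exp (α ^ 2 / 2 * (d' + d')) * L) ?_
    simp_rw [HoeghKrohn.inner_interaction hm hβ φ χ α hd hgi]
    exact ((Real.continuous_exp.tendsto _).comp
      (((hd'.comp tendsto_fst).add (hd'.comp tendsto_snd)).const_mul _)).mul hL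
  obtain ⟨V, hV⟩ := CompleteSpace.complete hcauchy
  exact ⟨HoeghKrohn.integrable_smul_wickExpCutoff hm hβ φ χ α hd hgi, hcauchy, V,
    ge_of_tendsto' hV (HoeghKrohn.interaction_nonneg hm hβ φ c χ hg α), hV⟩
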